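/- **Theorem 1.2 (mode stability; Whiting).** Let $|a|<M$ and put $r_\pm=M\pm\sqrt{M^2-a^2}$, $\Delta=r^2-2Mr+a^2$, $\rho^2=r^2+a^2\cos^2\theta$, $\Pi=(r^2+a^2)^2-a^2\sin^2\theta\,\Delta$. Let $g$ be the Kerr metric $$g=-\Big(1-\frac{2Mr}{\rho^2}\Big)dt^2-\frac{4Mar\sin^2\theta}{\rho^2}\,dt\,d\phi+\frac{\rho^2}{\Delta}dr^2+\rho^2d\theta^2+\sin^2\theta\,\frac{\Pi}{\rho^2}\,d\phi^2$$ in Boyer-Lindquist coordinates $(t,r,\theta,\phi)$ on $\mathcal M=\mathbb R\times(r_+,\infty)\times\mathbb S^2$, and let $r^*$ be a function on $(r_+,\infty)$ with $dr^*/dr=(r^2+a^2)/\Delta$. A smooth solution $\psi:\mathcal M\to\mathbb C$ of $\Box_g\psi=0$ is called a *mode solution* with parameters $\omega\in\mathbb C\setminus\{0\}$, $m\in\mathbb Z$ if $$\psi(t,r,\theta,\phi)=e^{-i\omega t}e^{im\phi}S(\theta)R(r),$$ where, for some $\lambda\in\mathbb C$: 1. $S$ is an eigenfunction (in particular $S\not\equiv0$)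 with eigenvalue $\lambda$ of the angular equation $$\frac1{\sin\theta}\frac{d}{d\theta}\Big(\sin\theta\frac{dS}{d\theta}\Big)-\Big(\frac{m^2}{\sin^2\theta}-a^2\omega^2\cos^2\theta\Big)S+\lambda S=0\quad\text{on }(0,\pi),$$ with the boundary condition that $e^{im\phi}S(\theta)$ extends smoothly to $\mathbb S^2$; 2. $R$ solves the radial equation $$\frac{d}{dr}\Big(\Delta\frac{dR}{dr}\Big)+\Big(\frac{(r^2+a^2)^2\omega^2-4Mamr\omega+a^2m^2}{\Delta}-\lambda-a^2\omega^2\Big)R=0\quad\text{on }(r_+,\infty);$$ 3. the function $R(r)\,(r-r_+)^{-\frac{i(am-2Mr_+\omega)}{r_+-r_-}}$ extends smoothly to $r=r_+$; 4. there are constants $C_0,C_1,C_2,\dots\in\mathbb C$ such that, for every $N\ge1$, $R(r)=\frac{e^{i\omega r^*}}{r}\sum_{i=0}^N\frac{C_i}{r^i}+O(r^{-N-2})$ as $r\to\infty$. Then there is no non-trivial mode solution with $\operatorname{Im}\omega>0$: every mode solution with $\operatorname{Im}\omega>0$ vanishes identically on $\mathcal M$. -/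

import Mathlib

open scoped Manifold
open Set Filter Asymptotics

noncomputable section

namespace Kerr

/-- The unit sphere `𝕊²` in Euclidean `ℝ³`, with Mathlib's smooth structure. -/
abbrev S2 : Type := Metric.sphere (0 : EuclideanSpace ℝ (Fin 3)) 1

/-- The point of `𝕊²` with polar angle `θ` and azimuth `φ`. -/
def spherePoint (θ φ : ℝ) : S2 :=
  ⟨!₂[Real.sin θ * Real.cos φ, Real.sin θ * Real.sin φ, Real.cos θ], by
    rw [mem_sphere_zero_iff_norm, EuclideanSpace.norm_eq, Real.sqrt_eq_one]
    simp only [Fin.sum_univ_three, Real.norm_eq_abs, sq_abs]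
    simp
    nlinarith [Real.sin_sq_add_cos_sq θ, Real.sin_sq_add_cos_sq φ]⟩

/-- The outer root `r₊` of `Δ`. -/
def rPlus (a M : ℝ) : ℝ := M + √(M ^ 2 - a ^ 2)

/-- The inner root `r₋` of `Δ`. -/
def rMinus (a M : ℝ) : ℝ := M - √(M ^ 2 - a ^ 2)

/-- `Δ = r² - 2Mr + a²`. -/
def Delta (a M r : ℝ) : ℝ := r ^ 2 - 2 * M * r + a ^ 2

/-- `ρ² = r² + a² cos² θ`. -/
def rhoSq (a r θ : ℝ) : ℝ := r ^ 2 + a ^ 2 * Real.cos θ ^ 2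

/-- `Π = (r² + a²)² - a² sin² θ Δ`. -/
def PiFun (a M r θ : ℝ) : ℝ :=
  (r ^ 2 + a ^ 2) ^ 2 - a ^ 2 * Real.sin θ ^ 2 * Delta a M r

/-- The Kerr metric in Boyer-Lindquist coordinates `x = (t, r, θ, φ)`. -/
def metric (a M : ℝ) (x : Fin 4 → ℝ) : Matrix (Fin 4) (Fin 4) ℝ :=
  let r := x 1
  let θ := x 2
  !![-(1 - 2 * M * r / rhoSq a r θ), 0, 0, -(2 * M * a * r * Real.sin θ ^ 2 / rhoSq a r θ);
     0, rhoSq a r θ / Delta a M r, 0, 0;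
     0, 0, rhoSq a r θ, 0;
     -(2 * M * a * r * Real.sin θ ^ 2 / rhoSq a r θ), 0, 0,
       Real.sin θ ^ 2 * (PiFun a M r θ / rhoSq a r θ)]

/-- The coordinate partial derivative `∂_μ f`. -/
def partialDeriv (μ : Fin 4) (f : (Fin 4 → ℝ) → ℂ) (x : Fin 4 → ℝ) : ℂ :=
  fderiv ℝ f x (Pi.single μ 1)

/-- The wave operator `□_g f = |det g|^{-1/2} ∂_μ (|det g|^{1/2} g^{μν} ∂_ν f)` of a metric `g`
given in coordinates. -/
def box (g : (Fin 4 → ℝ) → Matrix (Fin 4) (Fin 4) ℝ) (f : (Fin 4 → ℝ) → ℂ) (x : Fin 4 → ℝ) : ℂ :=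
  ((√|(g x).det| : ℝ) : ℂ)⁻¹ *
    ∑ μ, partialDeriv μ
      (fun y ↦ ∑ ν, ((√|(g y).det| * (g y)⁻¹ μ ν : ℝ) : ℂ) * partialDeriv ν f y) x

/-- The underlying manifold `ℝ × (r₊, ∞) × 𝕊²` of the exterior region, as an open subset of
`ℝ × ℝ × 𝕊²`. -/
def exterior (a M : ℝ) : Set (ℝ × ℝ × S2) := {p | rPlus a M < p.2.1}

/-- The event with Boyer-Lindquist coordinates `x = (t, r, θ, φ)`. -/
def blPoint (x : Fin 4 → ℝ) : ℝ × ℝ × S2 := (x 0, x 1, spherePoint (x 2) (x 3))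

/-- `ψ` is a smooth solution of `□_g ψ = 0` on the Kerr exterior. The equation is imposed wherever
the Boyer-Lindquist coordinates are regular, that is, off the axis; as `ψ` is smooth across the
axis and the complement of the axis is dense, this is the equation on all of the exterior. -/
structure IsSmoothWave (a M : ℝ) (ψ : ℝ × ℝ × S2 → ℂ) : Prop where
  smooth : ContMDiffOn (𝓘(ℝ, ℝ).prod (𝓘(ℝ, ℝ).prod (𝓡 2))) 𝓘(ℝ, ℂ) (⊤ : ℕ∞) ψ (exterior a M)
  box_eq_zero : ∀ x : Fin 4 → ℝ, rPlus a M < x 1 → 0 < x 2 → x 2 < Real.pi →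
    box (metric a M) (fun y ↦ ψ (blPoint y)) x = 0

/-- `S` is an eigenfunction, with eigenvalue `lam`, of the angular ODE
`(sin θ)⁻¹ (sin θ S')' - (m² / sin² θ - a² ω² cos² θ) S + lam S = 0` on `(0, π)` with the boundary
condition that `e^{imφ} S(θ)` extends smoothly to `𝕊²`. -/
structure IsAngularEigenfunction (a : ℝ) (ω : ℂ) (m : ℤ) (lam : ℂ) (S : ℝ → ℂ) : Prop where
  ne_zero : ∃ θ ∈ Ioo 0 Real.pi, S θ ≠ 0
  contDiffOn : ContDiffOn ℝ 2 S (Ioo 0 Real.pi)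
  ode : ∀ θ ∈ Ioo 0 Real.pi,
    1 / (Real.sin θ : ℂ) * deriv (fun τ : ℝ ↦ (Real.sin τ : ℂ) * deriv S τ) θ
      - ((m : ℂ) ^ 2 / (Real.sin θ : ℂ) ^ 2 - (a : ℂ) ^ 2 * ω ^ 2 * (Real.cos θ : ℂ) ^ 2) * S θ
      + lam * S θ = 0
  boundary : ∃ Y : S2 → ℂ, ContMDiff (𝓡 2) 𝓘(ℝ, ℂ) (⊤ : ℕ∞) Y ∧
    ∀ θ ∈ Ioo 0 Real.pi, ∀ φ : ℝ,
      Y (spherePoint θ φ) = Complex.exp (Complex.I * m * φ) * S θ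

/-- `R` solves the radial ODE
`(Δ R')' + (((r² + a²)² ω² - 4Mamrω + a²m²) / Δ - lam - a²ω²) R = 0` on `(r₊, ∞)`. -/
structure IsRadialSolution (a M : ℝ) (ω : ℂ) (m : ℤ) (lam : ℂ) (R : ℝ → ℂ) : Prop where
  contDiffOn : ContDiffOn ℝ 2 R (Ioi (rPlus a M))
  ode : ∀ r ∈ Ioi (rPlus a M),
    deriv (fun s : ℝ ↦ (Delta a M s : ℂ) * deriv R s) r
      + ((((r : ℂ) ^ 2 + (a : ℂ) ^ 2) ^ 2 * ω ^ 2 - 4 * M * a * m * r * ω + (a : ℂ) ^ 2 * (m : ℂ) ^ 2)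
          / (Delta a M r : ℂ) - lam - (a : ℂ) ^ 2 * ω ^ 2) * R r = 0

/-- The exponent `i (am - 2 M r₊ ω) / (r₊ - r₋)` at the horizon. -/
def horizonExponent (a M : ℝ) (ω : ℂ) (m : ℤ) : ℂ :=
  Complex.I * (a * m - 2 * M * rPlus a M * ω) / (rPlus a M - rMinus a M)

/-- `R ∼ (r - r₊)^{i(am - 2Mr₊ω)/(r₊ - r₋)}` at `r = r₊`: the quotient of the two sides is smooth
up to and including `r = r₊`. -/
def HorizonCondition (a M : ℝ) (ω : ℂ) (m : ℤ) (R : ℝ → ℂ) : Prop :=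
  ∃ ε > 0, ∃ f : ℝ → ℂ, ContDiffOn ℝ (⊤ : ℕ∞) f (Ico (rPlus a M) (rPlus a M + ε)) ∧
    ∀ r ∈ Ioo (rPlus a M) (rPlus a M + ε),
      f r = R r * ((r - rPlus a M : ℝ) : ℂ) ^ (-horizonExponent a M ω m)

/-- The tortoise coordinate `r*` on `(r₊, ∞)`, with one choice of its free additive constant. -/
def tortoise (a M r : ℝ) : ℝ :=
  r + 2 * M * rPlus a M / (rPlus a M - rMinus a M) * Real.log (r - rPlus a M)
    - 2 * M * rMinus a M / (rPlus a M - rMinus a M) * Real.log (r - rMinus a M)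

/-- The defining property `dr*/dr = (r² + a²) / Δ` of the tortoise coordinate. -/
theorem hasDerivAt_tortoise {a M r : ℝ} (h : |a| < M) (hr : rPlus a M < r) :
    HasDerivAt (tortoise a M) ((r ^ 2 + a ^ 2) / Delta a M r) r := by
  have hs : 0 < M ^ 2 - a ^ 2 := by
    have := sq_lt_sq.2 (h.trans_le (le_abs_self M)); linarith
  have hq := Real.sq_sqrt hs.le
  have hq0 := Real.sqrt_pos.2 hs
  unfold rPlus at hr
  have h1 : r - rPlus a M ≠ 0 := by unfold rPlus; linarith
  have h2 : r - rMinus a M ≠ 0 := by unfold rMinus; linarith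
  have h3 : rPlus a M - rMinus a M ≠ 0 := by unfold rPlus rMinus; linarith
  have hD : Delta a M r = (r - rPlus a M) * (r - rMinus a M) := by
    unfold Delta rPlus rMinus; nlinarith
  have e1 := (((hasDerivAt_id r).sub_const (rPlus a M)).log h1).const_mul
    (2 * M * rPlus a M / (rPlus a M - rMinus a M))
  have e2 := (((hasDerivAt_id r).sub_const (rMinus a M)).log h2).const_mul
    (2 * M * rMinus a M / (rPlus a M - rMinus a M))
  have e := ((hasDerivAt_id r).add e1).sub e2
  refine e.congr_deriv ?_
  have hsum : rPlus a M + rMinus a M = 2 * M := by unfold rPlus rMinus; ring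
  have hprod : rPlus a M * rMinus a M = a ^ 2 := by unfold rPlus rMinus; nlinarith
  rw [hD, ← hsum, ← hprod]
  simp only [id]
  field_simp
  ring

/-- `R ∼ e^{iωr*} / r` at `r = ∞`: there are constants `C₀, C₁, …` such that
`R = (e^{iωr*} / r) ∑_{i ≤ N} C_i / r^i + O(r^{-N-2})` as `r → ∞`, for every `N ≥ 1`. -/
def InfinityCondition (a M : ℝ) (ω : ℂ) (R : ℝ → ℂ) : Prop :=
  ∃ C : ℕ → ℂ, ∀ N : ℕ, 1 ≤ N →
    (fun r : ℝ ↦ R r - Complex.exp (Complex.I * ω * tortoise a M r) / r *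
        ∑ i ∈ Finset.range (N + 1), C i / (r : ℂ) ^ i)
      =O[atTop] (fun r : ℝ ↦ 1 / r ^ (N + 2))

/-- `ψ` is a mode solution on the Kerr exterior with frequency `ω` and azimuthal number `m`. -/
structure IsModeSolution (a M : ℝ) (ω : ℂ) (m : ℤ) (ψ : ℝ × ℝ × S2 → ℂ) : Prop where
  freq_ne_zero : ω ≠ 0
  wave : IsSmoothWave a M ψ
  separated : ∃ (lam : ℂ) (S R : ℝ → ℂ),
    IsAngularEigenfunction a ω m lam S ∧
    IsRadialSolution a M ω m lam R ∧
    HorizonCondition a M ω m R ∧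
    InfinityCondition a M ω R ∧
    ∀ t : ℝ, ∀ r ∈ Ioi (rPlus a M), ∀ θ ∈ Ioo 0 Real.pi, ∀ φ : ℝ,
      ψ (t, r, spherePoint θ φ) =
        Complex.exp (-Complex.I * ω * t) * Complex.exp (Complex.I * m * φ) * S θ * R r

end Kerr

end

/-! The tool is an energy identity. If `(p v')' + q v = 0` with `p ≥ 0`, then `Im (ω̄ p v' v̄)` has
derivative `-(Im (ω̄ q) |v|² + Im ω · p |v'|²)`. If `Im (ω̄ q) > 0` and this flux vanishes at both
ends, then `v = 0` (`sturmLiouville_energy`). Applied to the angular equation, it gives `Im (ω̄ λ) ≤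
0`.

The radial equation has no such sign when `a m ≠ 0`: the term `a² m² / Δ` contributes `-a² m² Im ω /
Δ` to `Im (ω̄ q)`. Whiting's transform removes it. With `s = r - r₊` and `d = r₊ - r₋`, multiply `R`
by the weight `W = s^ξ (s + d)^η e^{-iωs}`, where `ξ`, `η` are indicial exponents at `r₊`, `r₋`, and
take the Laplace transform at `z = -(2iω/d)(y + d)`. Against the kernel `e^{-zs} W` the radial
operator becomes multiplication by a quadratic polynomial in `s` (`radialNumerator_eval_add`), and
each factor `s` is a derivative in `z`, so the transform solves a second order equation in `y`
(`laplace_identity`). After the prefactor `y^{-2iMω} e^{iωy}` it reads `(y (y + d) v')' + q v = 0`,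
where `q` is a positive function times `ω²`, plus a real function times `ω`, minus `λ`. Hence `Im
(ω̄ q) > 0`.

Since `Im ω > 0`, the prefactor vanishes at `y = 0` and decays exponentially at infinity, so the
flux vanishes at both ends and `v = 0`. Injectivity of the Laplace transform on a ray
(`eq_zero_of_laplace_eq_zero`) then gives `R = 0`. -/

section Laplace

/-! ### Monotone fluxes and the Laplace transform of exponentially bounded functions -/

open MeasureTheory Topology

/-- A differentiable function with nonpositive derivative on an open convex set of reals that tends
to zero at both ends has zero derivative. -/
theorem deriv_eq_zero_of_nonpos_of_tendsto_zero {I : Set ℝ} (hI : Convex ℝ I) (hIo : IsOpen I)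
    {f f' : ℝ → ℝ} {l₁ l₂ : Filter ℝ} [l₁.NeBot] [l₂.NeBot]
    (h₁ : ∀ x ∈ I, ∀ᶠ y in l₁, y ∈ I ∧ y ≤ x) (h₂ : ∀ x ∈ I, ∀ᶠ y in l₂, y ∈ I ∧ x ≤ y)
    (hf : ∀ x ∈ I, HasDerivAt f (f' x) x) (hf' : ∀ x ∈ I, f' x ≤ 0)
    (t₁ : Tendsto f l₁ (𝓝 0)) (t₂ : Tendsto f l₂ (𝓝 0)) : ∀ x ∈ I, f' x = 0 := by
  have hanti : AntitoneOn f I := by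
    refine antitoneOn_of_deriv_nonpos hI (fun x hx ↦ (hf x hx).continuousAt.continuousWithinAt)
      (fun x hx ↦ (hf x (interior_subset hx)).differentiableAt.differentiableWithinAt) ?_
    intro x hx
    rw [(hf x (interior_subset hx)).deriv]
    exact hf' x (interior_subset hx)
  -- For an antitone function the limit at the left end is an upper bound and the limit at the right
  -- end a lower bound; both are zero.
  have hzero : ∀ x ∈ I, f x = 0 := by
    intro x hx
    apply le_antisymm
    · exact ge_of_tendsto t₁ ((h₁ x hx).mono fun y hy ↦ hanti hy.1 hx hy.2)
    · exact le_of_tendsto t₂ ((h₂ x hx).mono fun y hy ↦ hanti hx hy.1 hy.2)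
  intro x hx
  have : f =ᶠ[𝓝 x] fun _ ↦ 0 := by
    filter_upwards [hIo.mem_nhds hx] with y hy using hzero y hy
  exact (hf x hx).unique ((hasDerivAt_const x (0 : ℝ)).congr_of_eventuallyEq this)

/-- `h` is continuous on `(0, ∞)` and bounded there by a multiple of `e^{bs}`. -/
def IsExpBounded (b : ℝ) (h : ℝ → ℂ) : Prop :=
  ContinuousOn h (Ioi 0) ∧ ∃ C, ∀ s > 0, ‖h s‖ ≤ C * Real.exp (b * s)

/-- The Laplace transform. -/
noncomputable def laplace (h : ℝ → ℂ) (z : ℂ) : ℂ := ∫ s in Ioi (0 : ℝ), Complex.exp (-z * s) * h s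

namespace IsExpBounded

variable {b : ℝ} {h : ℝ → ℂ}

theorem id_mul (hh : IsExpBounded b h) {b' : ℝ} (hb : b < b') :
    IsExpBounded b' (fun s ↦ s * h s) := by
  obtain ⟨hc, C, hC⟩ := hh
  refine ⟨Complex.continuous_ofReal.continuousOn.mul hc, (b' - b)⁻¹ * C, fun s hs ↦ ?_⟩
  have hd : 0 < b' - b := by linarith
  have h1 : s ≤ (b' - b)⁻¹ * Real.exp ((b' - b) * s) := by
    rw [← div_eq_inv_mul, le_div_iff₀ hd]
    have := Real.add_one_le_exp ((b' - b) * s)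
    linarith
  have hC0 : 0 ≤ C * Real.exp (b * s) := (norm_nonneg _).trans (hC s hs)
  rw [norm_mul, Complex.norm_real, Real.norm_of_nonneg hs.le]
  calc s * ‖h s‖ ≤ ((b' - b)⁻¹ * Real.exp ((b' - b) * s)) * (C * Real.exp (b * s)) := by
        gcongr
        exact hC s hs
    _ = (b' - b)⁻¹ * C * (Real.exp ((b' - b) * s + b * s)) := by rw [Real.exp_add]; ring
    _ = _ := by ring_nf

theorem norm_kernel_mul_le {C : ℝ} (hC : ∀ s > 0, ‖h s‖ ≤ C * Real.exp (b * s)) (z : ℂ) {s : ℝ}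
    (hs : 0 < s) : ‖Complex.exp (-z * s) * h s‖ ≤ C * Real.exp (-(z.re - b) * s) := by
  rw [norm_mul, Complex.norm_exp]
  calc _ ≤ Real.exp (-z.re * s) * (C * Real.exp (b * s)) := by
        gcongr
        · simp
        · exact hC s hs
    _ = C * Real.exp (-z.re * s + b * s) := by rw [Real.exp_add]; ring
    _ = _ := by ring_nf

theorem continuousOn_kernel_mul (hh : IsExpBounded b h) (z : ℂ) :
    ContinuousOn (fun s : ℝ ↦ Complex.exp (-z * s) * h s) (Ioi 0) :=
  (by fun_prop : Continuous fun s : ℝ ↦ Complex.exp (-z * s)).continuousOn.mul hh.1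

theorem integrableOn (hh : IsExpBounded b h) {z : ℂ} (hz : b < z.re) :
    IntegrableOn (fun s : ℝ ↦ Complex.exp (-z * s) * h s) (Ioi 0) := by
  obtain ⟨C, hC⟩ := hh.2
  refine Integrable.mono' ((integrableOn_exp_mul_Ioi (a := -(z.re - b)) (by linarith) 0).const_mul C)
    ((hh.continuousOn_kernel_mul z).aestronglyMeasurable measurableSet_Ioi) ?_
  filter_upwards [ae_restrict_mem measurableSet_Ioi] with s hs
  exact norm_kernel_mul_le hC z hs

theorem norm_laplace_le (hh : IsExpBounded b h) :
    ∃ C, ∀ z : ℂ, b < z.re → ‖laplace h z‖ ≤ C / (z.re - b) := by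
  obtain ⟨C, hC⟩ := hh.2
  refine ⟨C, fun z hz ↦ ?_⟩
  have hz' : -(z.re - b) < 0 := by linarith
  calc ‖laplace h z‖ ≤ ∫ s in Ioi (0 : ℝ), C * Real.exp (-(z.re - b) * s) := by
        refine norm_integral_le_of_norm_le ((integrableOn_exp_mul_Ioi hz' 0).const_mul C) ?_
        filter_upwards [ae_restrict_mem measurableSet_Ioi] with s hs
        exact norm_kernel_mul_le hC z hs
    _ = _ := by
        rw [integral_const_mul, integral_exp_mul_Ioi hz']
        simp only [mul_zero, Real.exp_zero, neg_div_neg_eq, mul_one_div]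

theorem hasDerivAt_laplace (hh : IsExpBounded b h) {z : ℂ} (hz : b < z.re) :
    HasDerivAt (laplace h) (-laplace (fun s ↦ s * h s) z) z := by
  -- Rates `b < b' < x < Re z`: `b'` absorbs the factor `s` produced by differentiation, and `x`
  -- gives a dominating function uniform on the half plane `Re w > x`.
  obtain ⟨x, hx, hxz⟩ := exists_between hz
  obtain ⟨b', hb', hbx⟩ := exists_between hx
  have hid := hh.id_mul hb'
  obtain ⟨C, hC⟩ := hid.2
  have hnhds : {w : ℂ | x < w.re} ∈ 𝓝 z :=
    (isOpen_lt continuous_const Complex.continuous_re).mem_nhds hxz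
  have hC0 : 0 ≤ C := by
    have := (norm_nonneg _).trans (hC 1 one_pos)
    exact nonneg_of_mul_nonneg_left this (Real.exp_pos _)
  have key := (hasDerivAt_integral_of_dominated_loc_of_deriv_le (𝕜 := ℂ)
    (μ := volume.restrict (Ioi (0 : ℝ))) (F := fun w s ↦ Complex.exp (-w * (s : ℝ)) * h s)
    (F' := fun w s ↦ -(Complex.exp (-w * (s : ℝ)) * (s * h s)))
    (bound := fun s ↦ C * Real.exp (-(x - b') * s)) hnhds
    (Eventually.of_forall fun w ↦
      (hh.continuousOn_kernel_mul w).aestronglyMeasurable measurableSet_Ioi)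
    (hh.integrableOn hz)
    ((hid.continuousOn_kernel_mul z).aestronglyMeasurable measurableSet_Ioi).neg
    ?_ ((integrableOn_exp_mul_Ioi (by linarith) 0).const_mul C) ?_).2
  · rw [integral_neg] at key
    exact key
  · filter_upwards [ae_restrict_mem measurableSet_Ioi] with s hs w hw
    rw [norm_neg]
    refine (norm_kernel_mul_le hC w hs).trans ?_
    have hs' : (0 : ℝ) < s := hs
    have hw' : x < w.re := hw
    gcongr
  · refine Eventually.of_forall fun s w _ ↦ ?_
    have := (((hasDerivAt_id w).neg.mul_const (s : ℂ)).cexp).mul_const (h s)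
    refine this.congr_deriv ?_
    simp
    ring

/-- Injectivity of the Laplace transform, tested on a half line. -/
theorem eq_zero_of_laplace_eq_zero (hh : IsExpBounded b h) {z₀ z₁ : ℂ} (hz₀ : b < z₀.re)
    (hz₁ : 0 < z₁.re) (h0 : ∀ y : ℝ, 0 < y → laplace h (z₀ + y * z₁) = 0) :
    ∀ s > 0, h s = 0 := by
  have hopen : IsOpen {w : ℂ | b < w.re} := isOpen_lt continuous_const Complex.continuous_re
  have hconv : Convex ℝ {w : ℂ | b < w.re} := convex_halfSpace_re_gt b
  have han : AnalyticOnNhd ℂ (laplace h) {w : ℂ | b < w.re} :=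
    DifferentiableOn.analyticOnNhd
      (fun w hw ↦ (hh.hasDerivAt_laplace hw).differentiableAt.differentiableWithinAt) hopen
  have hz₁' : z₁ ≠ 0 := by rintro rfl; simp at hz₁
  -- The zeros on the ray accumulate at its origin `z₀`, which is interior to the half plane, so the
  -- identity theorem applies.
  have hfreq : ∃ᶠ w in 𝓝[≠] z₀, laplace h w = 0 := by
    have ht : Tendsto (fun y : ℝ ↦ z₀ + y * z₁) (𝓝[>] 0) (𝓝[≠] z₀) := by
      refine tendsto_nhdsWithin_iff.2 ⟨?_, ?_⟩
      · have : Continuous (fun y : ℝ ↦ z₀ + y * z₁) := by fun_prop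
        simpa using (this.tendsto 0).mono_left nhdsWithin_le_nhds
      · filter_upwards [self_mem_nhdsWithin] with y hy
        have : y ≠ 0 := ne_of_gt hy
        simp [this, hz₁']
    refine ht.frequently (Eventually.frequently ?_)
    filter_upwards [self_mem_nhdsWithin] with y hy using h0 y hy
  have hzero : EqOn (laplace h) 0 {w : ℂ | b < w.re} :=
    han.eqOn_zero_of_preconnected_of_frequently_eq_zero hconv.isPreconnected hz₀ hfreq
  -- On the line `Re z = c` the Laplace transform is the Fourier transform of `e^{-cs} h` extended
  -- by zero; `c` can be any real number above `b`.
  set c : ℝ := b + 1 with hc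
  set f : ℝ → ℂ := (Ioi (0 : ℝ)).indicator fun s ↦ Complex.exp (-(c : ℂ) * s) * h s with hf
  have hfi : Integrable f :=
    (integrable_indicator_iff measurableSet_Ioi).2 (hh.integrableOn (z := c) (by simp [hc]))
  have hF : FourierTransform.fourier f = 0 := by
    ext ξ
    rw [Real.fourier_real_eq_integral_exp_smul]
    have : ∀ v : ℝ, Complex.exp (↑(-2 * Real.pi * v * ξ) * Complex.I) • f v =
        (Ioi (0 : ℝ)).indicator
          (fun s ↦ Complex.exp (-((c : ℂ) + 2 * Real.pi * ξ * Complex.I) * s) * h s) v := by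
      intro v
      by_cases hv : v ∈ Ioi (0 : ℝ)
      · simp only [hf, indicator_of_mem hv, smul_eq_mul]
        rw [← mul_assoc, ← Complex.exp_add]
        congr 2
        push_cast
        ring
      · simp only [hf, indicator_of_notMem hv, smul_zero]
    simp_rw [this]
    rw [integral_indicator measurableSet_Ioi]
    exact hzero (show b < _ by simp [hc])
  intro s hs
  have hcont : ContinuousAt f s := by
    have h1 : ContinuousAt (fun s : ℝ ↦ Complex.exp (-(c : ℂ) * s) * h s) s :=
      (hh.continuousOn_kernel_mul c).continuousAt (Ioi_mem_nhds hs)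
    refine h1.congr ?_
    filter_upwards [Ioi_mem_nhds hs] with x hx
    simp only [hf, indicator_of_mem hx]
  have hinv := hfi.fourierInv_fourier_eq (by rw [hF]; exact integrable_zero _ _ _) hcont
  have hs' : s ∈ Ioi (0 : ℝ) := hs
  rw [hF, Real.fourierInv_eq'] at hinv
  simp only [Pi.zero_apply, smul_zero, integral_zero, hf, indicator_of_mem hs'] at hinv
  simpa using hinv.symm

end IsExpBounded

end Laplace

/-! ### The energy identity and the sign of the angular eigenvalue -/

section Angular

open Topology ComplexConjugate

/-- Energy argument for a Sturm-Liouville equation `(p v')' + q v = 0` whose energy flux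
`Im (ω̄ p v' v̄)` vanishes at both ends. -/
theorem sturmLiouville_energy {I : Set ℝ} (hI : Convex ℝ I) (hIo : IsOpen I)
    {l₁ l₂ : Filter ℝ} [l₁.NeBot] [l₂.NeBot]
    (h₁ : ∀ x ∈ I, ∀ᶠ y in l₁, y ∈ I ∧ y ≤ x) (h₂ : ∀ x ∈ I, ∀ᶠ y in l₂, y ∈ I ∧ x ≤ y)
    {ω : ℂ} (hω : 0 < ω.im) {p : ℝ → ℝ} {v v' T q : ℝ → ℂ}
    (hv : ∀ x ∈ I, HasDerivAt v (v' x) x) (hT : ∀ x ∈ I, HasDerivAt T (-(q x * v x)) x)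
    (hTp : ∀ x ∈ I, T x = p x * v' x) (hp : ∀ x ∈ I, 0 ≤ p x)
    (hq : ∀ x ∈ I, 0 ≤ (conj ω * q x).im)
    (t₁ : Tendsto (fun x ↦ T x * conj (v x)) l₁ (𝓝 0))
    (t₂ : Tendsto (fun x ↦ T x * conj (v x)) l₂ (𝓝 0)) :
    ∀ x ∈ I, (conj ω * q x).im * ‖v x‖ ^ 2 = 0 := by
  have hE : ∀ x ∈ I, HasDerivAt (fun x ↦ (conj ω * (T x * conj (v x))).im)
      (-((conj ω * q x).im * ‖v x‖ ^ 2 + ω.im * (p x * ‖v' x‖ ^ 2))) x := by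
    intro x hx
    have h1 : HasDerivAt (fun x ↦ conj ω * (T x * conj (v x)))
        (conj ω * (-(q x * v x) * conj (v x) + T x * conj (v' x))) x :=
      ((hT x hx).mul (hv x hx).star).const_mul _
    have h2 := (Complex.imCLM.hasFDerivAt (x := conj ω * (T x * conj (v x)))).comp_hasDerivAt x h1
    refine h2.congr_deriv ?_
    -- Both terms become real squares times `conj ω * q` and `conj ω`; the factor `conj ω` is what
    -- gives the `|v'|²` term the definite sign `-Im ω`.
    have e : conj ω * (-(q x * v x) * conj (v x) + T x * conj (v' x)) =
        -((conj ω * q x) * (v x * conj (v x))) + conj ω * (p x * (v' x * conj (v' x))) := by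
      rw [hTp x hx]; ring
    rw [e, Complex.mul_conj, Complex.mul_conj, Complex.normSq_eq_norm_sq, Complex.normSq_eq_norm_sq,
      ← Complex.ofReal_mul]
    simp only [Complex.imCLM_apply, Complex.add_im, Complex.neg_im, Complex.im_mul_ofReal,
      Complex.conj_im]
    ring
  have hlim : ∀ l : Filter ℝ, Tendsto (fun x ↦ T x * conj (v x)) l (𝓝 0) →
      Tendsto (fun x ↦ (conj ω * (T x * conj (v x))).im) l (𝓝 0) := by
    intro l hl
    have := (Complex.continuous_im.tendsto _).comp (hl.const_mul (conj ω))
    simpa only [mul_zero, Complex.zero_im] using! this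
  have hpos : ∀ x ∈ I, 0 ≤ (conj ω * q x).im * ‖v x‖ ^ 2 ∧ 0 ≤ ω.im * (p x * ‖v' x‖ ^ 2) :=
    fun x hx ↦ ⟨mul_nonneg (hq x hx) (by positivity),
      mul_nonneg hω.le (mul_nonneg (hp x hx) (by positivity))⟩
  intro x hx
  have := deriv_eq_zero_of_nonpos_of_tendsto_zero hI hIo h₁ h₂ hE
    (fun x hx ↦ by linarith [(hpos x hx).1, (hpos x hx).2]) (hlim _ t₁) (hlim _ t₂) x hx
  linarith [(hpos x hx).1, (hpos x hx).2]

namespace Kerr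

theorem contMDiff_spherePoint (φ : ℝ) :
    ContMDiff 𝓘(ℝ, ℝ) (𝓡 2) (⊤ : ℕ∞) (fun θ ↦ spherePoint θ φ) := by
  have : Fact (Module.finrank ℝ (EuclideanSpace ℝ (Fin 3)) = 2 + 1) := ⟨by simp⟩
  have h : ContMDiff 𝓘(ℝ, ℝ) 𝓘(ℝ, EuclideanSpace ℝ (Fin 3)) (⊤ : ℕ∞)
      (fun θ ↦ (spherePoint θ φ : EuclideanSpace ℝ (Fin 3))) := ?_
  · exact h.codRestrict_sphere (n := 2) fun θ ↦ (spherePoint θ φ).2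
  rw [contMDiff_iff_contDiff, contDiff_euclidean]
  intro i
  fin_cases i
  · exact Real.contDiff_sin.mul contDiff_const
  · exact Real.contDiff_sin.mul contDiff_const
  · exact Real.contDiff_cos

theorem hasDerivAt_deriv_of_contDiffOn {f : ℝ → ℂ} {U : Set ℝ} (hU : IsOpen U)
    (hf : ContDiffOn ℝ 2 f U) {x : ℝ} (hx : x ∈ U) :
    HasDerivAt f (deriv f x) x ∧ HasDerivAt (deriv f) (deriv (deriv f) x) x := by
  refine ⟨((hf.differentiableOn (by norm_num)).differentiableAt (hU.mem_nhds hx)).hasDerivAt, ?_⟩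
  have h1 : ContDiffOn ℝ 1 (deriv f) U :=
    ((contDiffOn_succ_iff_deriv_of_isOpen (n := 1) hU).1 (by simpa [one_add_one_eq_two] using hf)).2.2
  exact ((h1.differentiableOn (by norm_num)).differentiableAt (hU.mem_nhds hx)).hasDerivAt

/-- In `Im (ω̄ q)` the terms `-m² / sin² θ` and `a² ω² cos² θ` both contribute nonnegatively. If `Im
(ω̄ λ)` were positive, the energy identity would force `S = 0`. -/
theorem IsAngularEigenfunction.im_conj_mul_eigenvalue_nonpos {a : ℝ} {ω : ℂ} {m : ℤ} {lam : ℂ}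
    {S : ℝ → ℂ} (hS : IsAngularEigenfunction a ω m lam S) (hω : 0 < ω.im) :
    (conj ω * lam).im ≤ 0 := by
  by_contra! hpos
  obtain ⟨Y, hY, hYS⟩ := hS.boundary
  -- The restriction of `Y` to a full great circle is smooth through the poles, so `S` and `S'` stay
  -- bounded there and the factor `sin θ` kills the flux.
  set y : ℝ → ℂ := fun θ ↦ Y (spherePoint θ 0) with hy
  have hyc : ContDiff ℝ (⊤ : ℕ∞) y :=
    contMDiff_iff_contDiff.1 (hY.comp (contMDiff_spherePoint 0))
  have hSy : EqOn S y (Ioo 0 Real.pi) := fun θ hθ ↦ by simp [hy, hYS θ hθ 0]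
  have hdSy : EqOn (deriv S) (deriv y) (Ioo 0 Real.pi) := fun θ hθ ↦
    (hSy.eventuallyEq_of_mem (isOpen_Ioo.mem_nhds hθ)).deriv_eq
  have hcont : Continuous (fun θ ↦ Real.sin θ * deriv y θ * conj (y θ)) := by
    have h1 := hyc.continuous
    have h2 := hyc.continuous_deriv (by norm_num)
    fun_prop
  have hlim : ∀ θ₀, Real.sin θ₀ = 0 →
      Tendsto (fun θ ↦ Real.sin θ * deriv S θ * conj (S θ)) (𝓝[Ioo 0 Real.pi] θ₀) (𝓝 0) := by
    intro θ₀ h0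
    have h1 := (hcont.tendsto θ₀).mono_left (nhdsWithin_le_nhds (s := Ioo 0 Real.pi))
    simp only [h0, Complex.ofReal_zero, zero_mul] at h1
    refine h1.congr' ?_
    filter_upwards [self_mem_nhdsWithin] with θ hθ
    rw [hSy hθ, hdSy hθ]
  have hIm : ∀ θ ∈ Ioo 0 Real.pi, 0 < (conj ω * (Real.sin θ *
      (lam - (m : ℂ) ^ 2 / (Real.sin θ : ℂ) ^ 2 + (a : ℂ) ^ 2 * ω ^ 2 * (Real.cos θ : ℂ) ^ 2))).im := by
    intro θ hθ
    have hs := Real.sin_pos_of_mem_Ioo hθ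
    have e : conj ω * (Real.sin θ *
        (lam - (m : ℂ) ^ 2 / (Real.sin θ : ℂ) ^ 2 + (a : ℂ) ^ 2 * ω ^ 2 * (Real.cos θ : ℂ) ^ 2)) =
        (Real.sin θ : ℝ) * (conj ω * lam - ((m ^ 2 / Real.sin θ ^ 2 : ℝ) : ℂ) * conj ω +
          ((a ^ 2 * Real.cos θ ^ 2 * Complex.normSq ω : ℝ) : ℂ) * ω) := by
      push_cast
      rw [Complex.normSq_eq_conj_mul_self]
      ring
    rw [e, Complex.im_ofReal_mul]
    simp only [Complex.add_im, Complex.sub_im, Complex.im_ofReal_mul, Complex.conj_im]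
    have h1 : 0 ≤ (m ^ 2 / Real.sin θ ^ 2 : ℝ) * ω.im := by positivity
    have h2 : 0 ≤ (a ^ 2 * Real.cos θ ^ 2 * Complex.normSq ω : ℝ) * ω.im := by
      have := Complex.normSq_nonneg ω
      positivity
    refine mul_pos hs ?_
    linarith
  have l1 : (𝓝[Ioo 0 Real.pi] (0 : ℝ)).NeBot := left_nhdsWithin_Ioo_neBot Real.pi_pos
  have l2 : (𝓝[Ioo 0 Real.pi] Real.pi).NeBot := right_nhdsWithin_Ioo_neBot Real.pi_pos
  have key := sturmLiouville_energy (convex_Ioo 0 Real.pi) isOpen_Ioo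
    (l₁ := 𝓝[Ioo 0 Real.pi] 0) (l₂ := 𝓝[Ioo 0 Real.pi] Real.pi)
    (T := fun θ ↦ Real.sin θ * deriv S θ) (v := S) (v' := deriv S) (p := Real.sin) (hω := hω)
    (q := fun θ ↦ Real.sin θ *
      (lam - (m : ℂ) ^ 2 / (Real.sin θ : ℂ) ^ 2 + (a : ℂ) ^ 2 * ω ^ 2 * (Real.cos θ : ℂ) ^ 2))
  obtain ⟨θ, hθ, hSθ⟩ := hS.ne_zero
  have := key (fun x hx ↦ ?_) (fun x hx ↦ ?_)
    (fun x hx ↦ (hasDerivAt_deriv_of_contDiffOn isOpen_Ioo hS.contDiffOn hx).1) (fun x hx ↦ ?_)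
    (fun x _ ↦ rfl) (fun x hx ↦ (Real.sin_pos_of_mem_Ioo hx).le) (fun x hx ↦ (hIm x hx).le)
    (hlim 0 Real.sin_zero) (hlim Real.pi Real.sin_pi) θ hθ
  · rcases mul_eq_zero.1 this with h | h
    · exact (hIm θ hθ).ne' h
    · exact hSθ (by simpa using h)
  · filter_upwards [self_mem_nhdsWithin, nhdsWithin_le_nhds (Iic_mem_nhds hx.1)] with y h1 h2
    exact ⟨h1, h2⟩
  · filter_upwards [self_mem_nhdsWithin, nhdsWithin_le_nhds (Ici_mem_nhds hx.2)] with y h1 h2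
    exact ⟨h1, h2⟩
  · have hd : DifferentiableAt ℝ (fun τ : ℝ ↦ (Real.sin τ : ℂ) * deriv S τ) x :=
      (Real.hasDerivAt_sin x).ofReal_comp.differentiableAt.mul
        (hasDerivAt_deriv_of_contDiffOn isOpen_Ioo hS.contDiffOn hx).2.differentiableAt
    refine hd.hasDerivAt.congr_deriv ?_
    have hode := hS.ode x hx
    have hs : (Real.sin x : ℂ) ≠ 0 := by exact_mod_cast (Real.sin_pos_of_mem_Ioo hx).ne'
    generalize deriv (fun τ : ℝ ↦ (Real.sin τ : ℂ) * deriv S τ) x = D at hode ⊢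
    have : D = (Real.sin x : ℂ) * (1 / (Real.sin x : ℂ) * D) := by field_simp
    rw [this]
    linear_combination (Real.sin x : ℂ) * hode

end Kerr

end Angular

/-! ### Boundedness of the radial function and of its flux -/

section Radial

open Topology

namespace IsExpBounded

variable {b : ℝ} {h : ℝ → ℂ}

theorem mono (hh : IsExpBounded b h) {b' : ℝ} (hb : b ≤ b') : IsExpBounded b' h := by
  obtain ⟨hc, C, hC⟩ := hh
  refine ⟨hc, C, fun s hs ↦ (hC s hs).trans ?_⟩
  have : 0 ≤ C := nonneg_of_mul_nonneg_left ((norm_nonneg _).trans (hC s hs)) (Real.exp_pos _)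
  gcongr

theorem add (hh : IsExpBounded b h) {k : ℝ → ℂ} (hk : IsExpBounded b k) :
    IsExpBounded b (fun s ↦ h s + k s) := by
  obtain ⟨hc, C, hC⟩ := hh
  obtain ⟨kc, K, hK⟩ := hk
  refine ⟨hc.add kc, C + K, fun s hs ↦ (norm_add_le _ _).trans ?_⟩
  linarith [hC s hs, hK s hs]

theorem const_mul (hh : IsExpBounded b h) (c : ℂ) : IsExpBounded b (fun s ↦ c * h s) := by
  obtain ⟨hc, C, hC⟩ := hh
  refine ⟨continuousOn_const.mul hc, ‖c‖ * C, fun s hs ↦ ?_⟩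
  rw [norm_mul, mul_assoc]
  gcongr
  exact hC s hs

theorem mul (hh : IsExpBounded b h) {b' : ℝ} {k : ℝ → ℂ} (hk : IsExpBounded b' k) :
    IsExpBounded (b + b') (fun s ↦ h s * k s) := by
  obtain ⟨hc, C, hC⟩ := hh
  obtain ⟨kc, K, hK⟩ := hk
  refine ⟨hc.mul kc, C * K, fun s hs ↦ ?_⟩
  rw [norm_mul, add_mul, Real.exp_add]
  calc _ ≤ (C * Real.exp (b * s)) * (K * Real.exp (b' * s)) :=
        mul_le_mul (hC s hs) (hK s hs) (norm_nonneg _) ((norm_nonneg _).trans (hC s hs))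
    _ = _ := by ring

theorem polynomial_mul (hh : IsExpBounded b h) {b' : ℝ} (hb : b < b') (p : Polynomial ℂ) :
    IsExpBounded b' (fun s ↦ p.eval (s : ℂ) * h s) := by
  induction p using Polynomial.induction_on' with
  | add p q hp hq => simpa only [Polynomial.eval_add, add_mul] using hp.add hq
  | monomial n c =>
    have : ∀ b' > b, IsExpBounded b' (fun s ↦ (s : ℂ) ^ n * h s) := by
      induction n with
      | zero => exact fun b' hb' ↦ by simpa using hh.mono hb'.le
      | succ n ih =>
        intro b' hb'
        obtain ⟨x, hx, hx'⟩ := exists_between hb'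
        simpa only [pow_succ', mul_assoc] using (ih x hx).id_mul hx'
    simpa only [Polynomial.eval_monomial, mul_assoc] using (this b' hb).const_mul c

end IsExpBounded

namespace Kerr

variable {a M : ℝ}

theorem horizon_facts (h : |a| < M) : 0 < rPlus a M ∧ 0 ≤ rMinus a M ∧ rMinus a M < rPlus a M ∧
    rPlus a M + rMinus a M = 2 * M ∧ rPlus a M * rMinus a M = a ^ 2 := by
  have hM : 0 < M := (abs_nonneg a).trans_lt h
  have hs : 0 < M ^ 2 - a ^ 2 := by
    have := sq_lt_sq.2 (h.trans_le (le_abs_self M)); linarith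
  have hq := Real.sq_sqrt hs.le
  have hq0 := Real.sqrt_pos.2 hs
  have hle : √(M ^ 2 - a ^ 2) ≤ M := Real.sqrt_le_iff.2 ⟨hM.le, by nlinarith⟩
  unfold rPlus rMinus
  refine ⟨by linarith, by linarith, by linarith, by ring, by nlinarith⟩

/-- The numerator of the potential of the radial equation over the denominator `Δ`, in terms of
`s = r - r₊`. -/
noncomputable def radialNumerator (a M : ℝ) (ω : ℂ) (m : ℤ) (lam : ℂ) : Polynomial ℂ :=
  let r : Polynomial ℂ := Polynomial.X + Polynomial.C (rPlus a M : ℂ)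
  Polynomial.C (ω ^ 2) * (r ^ 2 + Polynomial.C ((a : ℂ) ^ 2)) ^ 2
    - Polynomial.C (4 * M * a * m * ω) * r + Polynomial.C ((a : ℂ) ^ 2 * (m : ℂ) ^ 2)
    - Polynomial.C (lam + (a : ℂ) ^ 2 * ω ^ 2) *
      (Polynomial.X * (Polynomial.X + Polynomial.C ((rPlus a M - rMinus a M : ℝ) : ℂ)))

/-- The radial equation as a first order system for `u = R` and `T = Δ R'` in terms of
`s = r - r₊`, for solutions which are bounded and have subexponential flux. -/
structure IsBoundedRadialSystem (a M : ℝ) (ω : ℂ) (m : ℤ) (lam : ℂ) (u T : ℝ → ℂ) : Prop where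
  hasDerivAt_fst : ∀ s : ℝ, 0 < s → HasDerivAt u (T s / (s * (s + (rPlus a M - rMinus a M : ℝ)))) s
  hasDerivAt_snd : ∀ s : ℝ, 0 < s → HasDerivAt T
    (-((radialNumerator a M ω m lam).eval (s : ℂ) / (s * (s + (rPlus a M - rMinus a M : ℝ))) * u s)) s
  bounded : IsExpBounded 0 u
  flux_bounded : ∀ μ > 0, IsExpBounded μ T

theorem hasDerivAt_ofReal_cpow_of_pos (ξ : ℂ) {s : ℝ} (hs : 0 < s) :
    HasDerivAt (fun s : ℝ ↦ (s : ℂ) ^ ξ) (ξ * (s : ℂ) ^ (ξ - 1)) s := by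
  simpa using ((hasDerivAt_id (s : ℂ)).cpow_const (c := ξ) (Or.inl (by simpa using hs))).comp_ofReal

theorem Delta_eq (h : |a| < M) (s : ℝ) :
    Delta a M (s + rPlus a M) = s * (s + (rPlus a M - rMinus a M)) := by
  obtain ⟨-, -, -, h1, h2⟩ := horizon_facts h
  unfold Delta
  linear_combination (s + rPlus a M) * h1 - h2

/-- The part with `a m` is purely imaginary; the real part is `2 M r₊ Im ω / (r₊ - r₋)`. -/
theorem re_horizonExponent_pos (h : |a| < M) {ω : ℂ} (hω : 0 < ω.im) (m : ℤ) :
    0 < (horizonExponent a M ω m).re := by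
  obtain ⟨h1, -, h2, -, -⟩ := horizon_facts h
  have hM : 0 < M := (abs_nonneg a).trans_lt h
  have e : horizonExponent a M ω m = (((rPlus a M - rMinus a M)⁻¹ : ℝ) : ℂ) *
      (Complex.I * (((a * m : ℝ) : ℂ) - ((2 * M * rPlus a M : ℝ) : ℂ) * ω)) := by
    unfold horizonExponent
    push_cast
    ring
  rw [e, Complex.re_ofReal_mul, Complex.I_mul_re, Complex.sub_im, Complex.ofReal_im,
    Complex.im_ofReal_mul]
  have : 0 < rPlus a M - rMinus a M := by linarith
  have : 0 < 2 * M * rPlus a M * ω.im := by positivity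
  rw [zero_sub, neg_neg]
  positivity

theorem HorizonCondition.bounded {ω : ℂ} {m : ℤ} {R : ℝ → ℂ} (h : |a| < M) (hω : 0 < ω.im)
    (hR : HorizonCondition a M ω m R) :
    ∃ δ > 0, ∃ C, ∀ s ∈ Ioo 0 δ, ‖R (s + rPlus a M)‖ ≤ C ∧
      ‖(s : ℂ) * deriv R (s + rPlus a M)‖ ≤ C := by
  obtain ⟨ε, hε, f, hf, hfR⟩ := hR
  set r₀ := rPlus a M
  set ξ := horizonExponent a M ω m
  have hξ : 0 < ξ.re := re_horizonExponent_pos h hω m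
  have hsub : Icc r₀ (r₀ + ε / 2) ⊆ Ico r₀ (r₀ + ε) := fun r hr ↦ ⟨hr.1, by linarith [hr.2]⟩
  obtain ⟨A, hA⟩ := isCompact_Icc.exists_bound_of_continuousOn (hf.continuousOn.mono hsub)
  obtain ⟨B, hB⟩ := isCompact_Icc.exists_bound_of_continuousOn
    ((hf.continuousOn_derivWithin (uniqueDiffOn_Ico _ _) (by norm_num)).mono hsub)
  have hform : ∀ r ∈ Ioo r₀ (r₀ + ε), R r = f r * ((r - r₀ : ℝ) : ℂ) ^ ξ := by
    intro r hr
    have hne : ((r - r₀ : ℝ) : ℂ) ≠ 0 := by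
      exact_mod_cast (sub_pos.2 hr.1).ne'
    rw [hfR r hr, mul_assoc, ← Complex.cpow_add _ _ hne, neg_add_cancel, Complex.cpow_zero, mul_one]
  have hnorm : ∀ s : ℝ, 0 < s → s ≤ 1 → ‖(s : ℂ) ^ ξ‖ ≤ 1 := by
    intro s hs hs1
    rw [Complex.norm_cpow_eq_rpow_re_of_pos hs]
    exact Real.rpow_le_one hs.le hs1 hξ.le
  -- `ε / 2` keeps to a compact interval on which `f` and `f'` are bounded; `s ≤ 1` gives `|s^ξ| ≤
  -- 1`.
  refine ⟨min (ε / 2) 1, by positivity, A + (B + A * ‖ξ‖), fun s hs ↦ ?_⟩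
  have hs0 : 0 < s := hs.1
  have hs1 : s < 1 := hs.2.trans_le (min_le_right _ _)
  have hsε : s < ε / 2 := hs.2.trans_le (min_le_left _ _)
  have hmem : s + r₀ ∈ Ioo r₀ (r₀ + ε) := ⟨by linarith, by linarith⟩
  have hmem' : s + r₀ ∈ Icc r₀ (r₀ + ε / 2) := ⟨by linarith, by linarith⟩
  have hA' := hA _ hmem'
  have hB' := hB _ hmem'
  have hA0 : 0 ≤ A := (norm_nonneg _).trans hA'
  have hB0 : 0 ≤ B := (norm_nonneg _).trans hB'
  have hpow := hnorm s hs0 hs1.le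
  have hsne : (s : ℂ) ≠ 0 := by exact_mod_cast hs0.ne'
  constructor
  · rw [hform _ hmem, add_sub_cancel_right, norm_mul]
    have : ‖f (s + r₀)‖ * ‖(s : ℂ) ^ ξ‖ ≤ A * 1 := by gcongr
    nlinarith [norm_nonneg ξ]
  · have hdf : HasDerivAt f (derivWithin f (Ico r₀ (r₀ + ε)) (s + r₀)) (s + r₀) :=
      (((hf.differentiableOn (by norm_num)) _ (hsub hmem')).hasDerivWithinAt).hasDerivAt
        (Ico_mem_nhds hmem.1 hmem.2)
    have hcp : HasDerivAt (fun r : ℝ ↦ ((r - r₀ : ℝ) : ℂ) ^ ξ)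
        (ξ * (s : ℂ) ^ (ξ - 1)) (s + r₀) := by
      exact (hasDerivAt_ofReal_cpow_of_pos ξ (by simpa using hs0)).comp_sub_const
        (s + r₀) r₀ |>.congr_deriv
        (by simp)
    have hRd : deriv R (s + r₀) = derivWithin f (Ico r₀ (r₀ + ε)) (s + r₀) * (s : ℂ) ^ ξ +
        f (s + r₀) * (ξ * (s : ℂ) ^ (ξ - 1)) := by
      have := hdf.mul hcp
      rw [add_sub_cancel_right] at this
      refine (this.congr_of_eventuallyEq ?_).deriv
      filter_upwards [isOpen_Ioo.mem_nhds hmem] with r hr using hform r hr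
    have e : (s : ℂ) * deriv R (s + r₀) = (s * derivWithin f (Ico r₀ (r₀ + ε)) (s + r₀) +
        f (s + r₀) * ξ) * (s : ℂ) ^ ξ := by
      rw [hRd, Complex.cpow_sub _ _ hsne, Complex.cpow_one]
      field_simp
    rw [e, norm_mul]
    calc _ ≤ (1 * B + A * ‖ξ‖) * 1 := by
          gcongr
          refine (norm_add_le _ _).trans ?_
          rw [norm_mul, norm_mul, Complex.norm_real, Real.norm_of_nonneg hs0.le]
          gcongr
      _ ≤ _ := by linarith

theorem tortoise_monotoneOn (h : |a| < M) : MonotoneOn (tortoise a M) (Ioi (rPlus a M)) := by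
  obtain ⟨h1, h2, h3, -, -⟩ := horizon_facts h
  refine monotoneOn_of_deriv_nonneg (convex_Ioi _)
    (fun r hr ↦ (hasDerivAt_tortoise h hr).continuousAt.continuousWithinAt)
    (fun r hr ↦ (hasDerivAt_tortoise h (interior_subset hr)).differentiableAt.differentiableWithinAt)
    fun r hr ↦ ?_
  have hr' : rPlus a M < r := interior_subset hr
  rw [(hasDerivAt_tortoise h hr').deriv]
  have := Delta_eq h (r - rPlus a M)
  rw [sub_add_cancel] at this
  have hpos : 0 < Delta a M r := by
    rw [this]
    exact mul_pos (by linarith) (by linarith)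
  positivity

/-- `|e^{iωr*}| = e^{-Im ω · r*}` is bounded away from the horizon because `r*` increases.
Boundedness is enough: the Laplace kernel supplies the decay, so the case `N = 1` of the expansion
suffices. -/
theorem InfinityCondition.bounded {ω : ℂ} {R : ℝ → ℂ} (h : |a| < M) (hω : 0 < ω.im)
    (hR : InfinityCondition a M ω R) : ∃ C, ∀ᶠ r in atTop, ‖R r‖ ≤ C := by
  obtain ⟨c, hc⟩ := hR
  obtain ⟨K, hK⟩ := (hc 1 le_rfl).bound
  set τ := tortoise a M (rPlus a M + 1)
  refine ⟨|K| + Real.exp (-(ω.im * τ)) * (‖c 0‖ + ‖c 1‖), ?_⟩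
  filter_upwards [hK, eventually_ge_atTop 1, eventually_ge_atTop (rPlus a M + 1)] with r hr h1 h2
  have hτ : τ ≤ tortoise a M r :=
    tortoise_monotoneOn h (by simp) (show rPlus a M < r by linarith) h2
  have hr0 : 0 < r := by linarith
  have e1 : ‖Complex.exp (Complex.I * ω * tortoise a M r) / r *
      ∑ i ∈ Finset.range (1 + 1), c i / (r : ℂ) ^ i‖ ≤
      Real.exp (-(ω.im * τ)) * (‖c 0‖ + ‖c 1‖) := by
    rw [norm_mul]
    gcongr
    · rw [norm_div, Complex.norm_exp, Complex.norm_real, Real.norm_of_nonneg hr0.le]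
      have : (Complex.I * ω * tortoise a M r).re = -(ω.im * tortoise a M r) := by simp
      rw [this]
      refine (div_le_self (Real.exp_pos _).le h1).trans ?_
      gcongr
    · refine (norm_sum_le _ _).trans ?_
      simp only [Finset.sum_range_succ, Finset.range_zero, Finset.sum_empty, zero_add, pow_zero,
        div_one, pow_one, norm_div, Complex.norm_real, Real.norm_of_nonneg hr0.le, norm_one]
      gcongr
      exact div_le_self (norm_nonneg _) h1
  have e2 : K * ‖1 / r ^ (1 + 2)‖ ≤ |K| := by
    have hb : ‖1 / r ^ (1 + 2)‖ ≤ 1 := by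
      rw [Real.norm_of_nonneg (by positivity)]
      exact div_le_one_of_le₀ (one_le_pow₀ h1) (by positivity)
    calc K * ‖1 / r ^ (1 + 2)‖ ≤ |K| * 1 := by gcongr; exact le_abs_self K
      _ = _ := mul_one _
  calc ‖R r‖ = ‖(R r - Complex.exp (Complex.I * ω * tortoise a M r) / r *
        ∑ i ∈ Finset.range (1 + 1), c i / (r : ℂ) ^ i) +
        Complex.exp (Complex.I * ω * tortoise a M r) / r *
        ∑ i ∈ Finset.range (1 + 1), c i / (r : ℂ) ^ i‖ := by rw [sub_add_cancel]
    _ ≤ _ := (norm_add_le _ _).trans (add_le_add (hr.trans e2) e1)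

theorem IsRadialSolution.isBoundedRadialSystem {ω : ℂ} {m : ℤ} {lam : ℂ} {R : ℝ → ℂ}
    (h : |a| < M) (hω : 0 < ω.im) (hR : IsRadialSolution a M ω m lam R)
    (hhor : HorizonCondition a M ω m R) (hinf : InfinityCondition a M ω R) :
    IsBoundedRadialSystem a M ω m lam (fun s ↦ R (s + rPlus a M))
      (fun s ↦ s * (s + (rPlus a M - rMinus a M : ℝ)) * deriv R (s + rPlus a M)) := by
  obtain ⟨hp, hm, hlt, hsum, hprod⟩ := horizon_facts h
  set d : ℝ := rPlus a M - rMinus a M with hd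
  have hd0 : 0 < d := by linarith
  have hDelta : ∀ s : ℝ, (Delta a M (s + rPlus a M) : ℂ) = s * (s + d) := by
    intro s
    rw [Delta_eq h]
    push_cast [hd]
    ring
  set u : ℝ → ℂ := fun s ↦ R (s + rPlus a M)
  set T : ℝ → ℂ := fun s ↦ s * (s + d) * deriv R (s + rPlus a M)
  have hreg : ∀ r > rPlus a M,
      HasDerivAt R (deriv R r) r ∧ HasDerivAt (deriv R) (deriv (deriv R) r) r :=
    fun r hr ↦ hasDerivAt_deriv_of_contDiffOn isOpen_Ioi hR.contDiffOn hr
  have hu : ∀ s : ℝ, 0 < s → HasDerivAt u (T s / (s * (s + d))) s := by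
    intro s hs
    have h1 := (hreg (s + rPlus a M) (by linarith)).1.comp_add_const s (rPlus a M)
    refine h1.congr_deriv ?_
    have : (s : ℂ) * (s + d) ≠ 0 := by
      exact_mod_cast (by positivity : s * (s + d) ≠ 0)
    rw [mul_div_cancel_left₀ _ this]
  have hT : ∀ s : ℝ, 0 < s → HasDerivAt T
      (-((radialNumerator a M ω m lam).eval (s : ℂ) / (s * (s + d)) * u s)) s := by
    intro s hs
    have hr : rPlus a M < s + rPlus a M := by linarith
    have hdiff : DifferentiableAt ℝ (fun s : ℝ ↦ (Delta a M s : ℂ) * deriv R s)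
        (s + rPlus a M) := by
      refine DifferentiableAt.mul ?_ (hreg _ hr).2.differentiableAt
      have : Differentiable ℝ (Delta a M) := by unfold Delta; fun_prop
      exact (this _).hasDerivAt.ofReal_comp.differentiableAt
    have h1 := hdiff.hasDerivAt.comp_add_const s (rPlus a M)
    simp only [hDelta] at h1
    refine h1.congr_deriv ?_
    have hode := hR.ode _ hr
    rw [hDelta] at hode
    have hne : (s : ℂ) * (s + d) ≠ 0 := by
      exact_mod_cast (by positivity : s * (s + d) ≠ 0)
    have e : (radialNumerator a M ω m lam).eval (s : ℂ) / (s * (s + d)) =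
        ((((s + rPlus a M : ℝ) : ℂ) ^ 2 + (a : ℂ) ^ 2) ^ 2 * ω ^ 2
          - 4 * M * a * m * (s + rPlus a M : ℝ) * ω + (a : ℂ) ^ 2 * (m : ℂ) ^ 2) / (s * (s + d))
          - lam - (a : ℂ) ^ 2 * ω ^ 2 := by
      rw [sub_sub, eq_sub_iff_add_eq, div_add' _ _ _ hne]
      congr 1
      simp only [radialNumerator, Polynomial.eval_add, Polynomial.eval_sub, Polynomial.eval_mul,
        Polynomial.eval_pow, Polynomial.eval_X, Polynomial.eval_C]
      push_cast [hd]
      ring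
    rw [e]
    linear_combination hode
  have huc : ContinuousOn u (Ioi 0) := fun s hs ↦ (hu s hs).continuousAt.continuousWithinAt
  have hTc : ContinuousOn T (Ioi 0) := fun s hs ↦ (hT s hs).continuousAt.continuousWithinAt
  obtain ⟨δ, hδ, A, hA⟩ := hhor.bounded h hω
  obtain ⟨B, hB⟩ := hinf.bounded h hω
  have hB' : ∀ᶠ s in atTop, ‖u s‖ ≤ B := (tendsto_atTop_add_const_right _ _ tendsto_id).eventually hB
  obtain ⟨s₁, hs₁⟩ := eventually_atTop.1 hB'
  have hsub : ∀ x, Icc (δ / 2) x ⊆ Ioi 0 := fun x s hs ↦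
    show (0 : ℝ) < s by linarith [hs.1]
  obtain ⟨K, hK⟩ := isCompact_Icc.exists_bound_of_continuousOn (huc.mono (hsub s₁))
  have hub : IsExpBounded 0 u := by
    refine ⟨huc, max A (max K B), fun s hs ↦ ?_⟩
    simp only [zero_mul, Real.exp_zero, mul_one, le_max_iff]
    by_cases h1 : s < δ / 2
    · exact Or.inl (hA s ⟨hs, by linarith⟩).1
    · by_cases h2 : s ≤ s₁
      · exact Or.inr (Or.inl (hK s ⟨not_lt.1 h1, h2⟩))
      · exact Or.inr (Or.inr (hs₁ s (not_le.1 h2).le))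
  refine ⟨hu, hT, hub, fun μ hμ ↦ ⟨hTc, ?_⟩⟩
  obtain ⟨L, hL⟩ := (hub.polynomial_mul hμ (radialNumerator a M ω m lam)).2
  set s₀ := δ / 2 with hs₀
  have hs₀0 : 0 < s₀ := by positivity
  have hL0 : 0 ≤ L := nonneg_of_mul_nonneg_left ((norm_nonneg _).trans (hL 1 one_pos)) (Real.exp_pos _)
  set L' := L / (s₀ * d) with hL'
  have hL'0 : 0 ≤ L' := by positivity
  -- Away from the horizon the bound on `T` comes from integrating its equation: `T'` is a
  -- polynomial times the bounded `u`, divided by `s (s + d) ≥ s₀ d`. Nearer the horizon it comes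
  -- from the bound on `s R'`.
  have hTfar : ∀ s ≥ s₀, ‖T s‖ ≤ ‖T s₀‖ + L' / μ * Real.exp (μ * s) := by
    intro s hs
    refine image_norm_le_of_norm_deriv_right_le_deriv_boundary (a := s₀) (b := s) (E := ℂ) (f := T)
      (f' := fun s ↦ -((radialNumerator a M ω m lam).eval (s : ℂ) / (s * (s + d)) * u s))
      (B := fun s ↦ ‖T s₀‖ + L' / μ * Real.exp (μ * s)) (B' := fun s ↦ L' * Real.exp (μ * s))
      (hTc.mono (hsub s)) (fun x hx ↦ (hT x (by linarith [hx.1])).hasDerivWithinAt) ?_ ?_ ?_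
      ⟨hs, le_rfl⟩
    · have : 0 ≤ L' / μ * Real.exp (μ * s₀) := by positivity
      linarith
    · intro x
      have h1 := (((hasDerivAt_id x).const_mul μ).exp.const_mul (L' / μ)).const_add ‖T s₀‖
      refine h1.congr_deriv ?_
      simp only [id, mul_one]
      field_simp
    · intro x hx
      have hx0 : 0 < x := by linarith [hx.1]
      have h1 := hL x hx0
      rw [norm_neg, div_mul_eq_mul_div, norm_div]
      have h2 : ‖(x : ℂ) * (x + d)‖ = x * (x + d) := by
        rw [← Complex.ofReal_add, ← Complex.ofReal_mul, Complex.norm_real,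
          Real.norm_of_nonneg (by positivity)]
      rw [h2, hL', div_mul_eq_mul_div]
      have h3 : s₀ * d ≤ x * (x + d) := mul_le_mul hx.1 (by linarith) hd0.le hx0.le
      gcongr
  refine ⟨max (A * (δ + d)) (‖T s₀‖ + L' / μ), fun s hs ↦ ?_⟩
  have hexp : 1 ≤ Real.exp (μ * s) := Real.one_le_exp (by positivity)
  by_cases h1 : s < s₀
  · have hA2 := (hA s ⟨hs, by linarith⟩).2
    have hA0 : 0 ≤ A := (norm_nonneg _).trans hA2
    calc ‖T s‖ = ‖(s : ℂ) * deriv R (s + rPlus a M)‖ * (s + d) := by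
          have : ‖((s + d : ℝ) : ℂ)‖ = s + d := by
            rw [Complex.norm_real, Real.norm_of_nonneg (by positivity)]
          rw [← this, ← norm_mul]
          congr 1
          simp only [T]
          push_cast
          ring
      _ ≤ A * (δ + d) * 1 := by
          rw [mul_one]
          gcongr
          linarith
      _ ≤ _ := by
          gcongr
          exact le_max_left _ _
  · calc ‖T s‖ ≤ ‖T s₀‖ * 1 + L' / μ * Real.exp (μ * s) := by
          simpa using hTfar s (not_lt.1 h1)
      _ ≤ (‖T s₀‖ + L' / μ) * Real.exp (μ * s) := by
          rw [add_mul]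
          gcongr
      _ ≤ _ := by
          gcongr
          exact le_max_right _ _

end Kerr

end Radial

/-! ### Whiting's weight and the cancellation of the singular terms -/

section Transform

open Topology ComplexConjugate

namespace IsExpBounded

variable {b : ℝ} {h : ℝ → ℂ}

theorem tendsto_atTop (hh : IsExpBounded b h) (hb : b < 0) : Tendsto h atTop (𝓝 0) := by
  obtain ⟨C, hC⟩ := hh.2
  have h1 : Tendsto (fun s ↦ C * Real.exp (b * s)) atTop (𝓝 0) := by
    simpa using (Real.tendsto_exp_atBot.comp (tendsto_id.const_mul_atTop_of_neg hb)).const_mul C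
  refine squeeze_zero_norm' ?_ h1
  filter_upwards [eventually_gt_atTop 0] with s hs using hC s hs

theorem tendsto_zero_mul (hh : IsExpBounded b h) {f : ℝ → ℂ} (hf : Tendsto f (𝓝[>] 0) (𝓝 0)) :
    Tendsto (fun s ↦ f s * h s) (𝓝[>] 0) (𝓝 0) := by
  obtain ⟨C, hC⟩ := hh.2
  have h1 : Tendsto (fun s ↦ C * Real.exp (b * s)) (𝓝[>] 0) (𝓝 (C * Real.exp (b * 0))) :=
    ((by fun_prop : Continuous fun s ↦ C * Real.exp (b * s)).tendsto 0).mono_left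
      nhdsWithin_le_nhds
  have h2 := hf.norm.mul h1
  rw [norm_zero, zero_mul] at h2
  refine squeeze_zero_norm' ?_ h2
  filter_upwards [self_mem_nhdsWithin] with s hs
  rw [norm_mul]
  gcongr
  exact hC s hs

theorem star_comp (hh : IsExpBounded b h) : IsExpBounded b (fun s ↦ conj (h s)) := by
  obtain ⟨hc, C, hC⟩ := hh
  exact ⟨Complex.continuous_conj.comp_continuousOn hc, C, fun s hs ↦ by
    rw [Complex.norm_conj]; exact hC s hs⟩

theorem cexp (c : ℂ) : IsExpBounded c.re (fun s ↦ Complex.exp (c * s)) :=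
  ⟨by fun_prop, 1, fun s _ ↦ by simp [Complex.norm_exp]⟩

/-- Raise `t ≤ e^t`, with `t = s ε / Re x`, to the power `Re x`. -/
theorem cpow {x : ℂ} (hx : 0 < x.re) {ε : ℝ} (hε : 0 < ε) :
    IsExpBounded ε (fun s ↦ (s : ℂ) ^ x) := by
  refine ⟨fun s hs ↦ (Kerr.hasDerivAt_ofReal_cpow_of_pos x hs).continuousAt.continuousWithinAt,
    ((ε / x.re) ^ x.re)⁻¹, fun s hs ↦ ?_⟩
  have hc : 0 < ε / x.re := by positivity
  rw [Complex.norm_cpow_eq_rpow_re_of_pos hs, ← div_eq_inv_mul, le_div_iff₀ (by positivity),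
    ← Real.mul_rpow hs.le hc.le]
  calc (s * (ε / x.re)) ^ x.re ≤ Real.exp (s * (ε / x.re)) ^ x.re := by
        gcongr
        linarith [Real.add_one_le_exp (s * (ε / x.re))]
    _ = Real.exp (ε * s) := by
        rw [← Real.exp_mul]
        congr 1
        field_simp

theorem laplace_comp (hh : IsExpBounded b h) {z₀ z₁ : ℂ} (hz₀ : b < z₀.re) (hz₁ : 0 < z₁.re) :
    IsExpBounded 0 (fun y ↦ laplace h (z₀ + y * z₁)) := by
  have hre : ∀ y > 0, z₀.re ≤ (z₀ + (y : ℝ) * z₁).re := by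
    intro y hy
    have : 0 < y * z₁.re := by positivity
    rw [Complex.add_re, Complex.re_ofReal_mul]
    linarith
  obtain ⟨C, hC⟩ := hh.norm_laplace_le
  have hC0 : 0 ≤ C := by
    have h1 := (norm_nonneg _).trans (hC z₀ hz₀)
    have h2 : 0 < z₀.re - b := by linarith
    simpa [h2.ne'] using mul_nonneg h1 h2.le
  refine ⟨fun y hy ↦ ?_, C / (z₀.re - b), fun y hy ↦ ?_⟩
  · have h1 := (hh.hasDerivAt_laplace (hz₀.trans_le (hre y hy))).continuousAt
    exact (h1.comp (f := fun y : ℝ ↦ z₀ + y * z₁) (by fun_prop)).continuousWithinAt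
  · rw [zero_mul, Real.exp_zero, mul_one]
    refine (hC _ (hz₀.trans_le (hre y hy))).trans ?_
    have := hre y hy
    have h2 : 0 < z₀.re - b := by linarith
    gcongr

theorem hasDerivAt_laplace_comp (hh : IsExpBounded b h) {z₀ z₁ : ℂ} (hz₀ : b < z₀.re)
    (hz₁ : 0 < z₁.re) {y : ℝ} (hy : 0 < y) :
    HasDerivAt (fun y : ℝ ↦ laplace h (z₀ + y * z₁))
      (-z₁ * laplace (fun s ↦ s * h s) (z₀ + y * z₁)) y := by
  have h0 : b < (z₀ + y * z₁).re := by
    have : 0 < y * z₁.re := by positivity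
    rw [Complex.add_re, Complex.re_ofReal_mul]
    linarith
  have h1 : HasDerivAt (fun y : ℝ ↦ z₀ + y * z₁) z₁ y := by
    simpa using ((hasDerivAt_id y).ofReal_comp.mul_const z₁).const_add z₀
  refine ((hh.hasDerivAt_laplace h0).comp y h1).congr_deriv ?_
  ring

end IsExpBounded

theorem tendsto_ofReal_cpow_zero {x : ℂ} (hx : 0 < x.re) :
    Tendsto (fun s : ℝ ↦ (s : ℂ) ^ x) (𝓝[>] 0) (𝓝 0) := by
  have h1 : Tendsto (fun s : ℝ ↦ s ^ x.re) (𝓝[>] 0) (𝓝 0) := by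
    have := (Real.continuousAt_rpow_const 0 x.re (Or.inr hx.le)).tendsto
    rw [Real.zero_rpow hx.ne'] at this
    exact this.mono_left nhdsWithin_le_nhds
  refine squeeze_zero_norm' ?_ h1
  filter_upwards [self_mem_nhdsWithin] with s hs
  exact (Complex.norm_cpow_eq_rpow_re_of_pos hs x).le

namespace Kerr

variable {a M : ℝ}

/-- The exponent `-i (am - 2 M r₋ ω) / (r₊ - r₋)` at the inner root. -/
noncomputable def innerExponent (a M : ℝ) (ω : ℂ) (m : ℤ) : ℂ :=
  -(Complex.I * (a * m - 2 * M * rMinus a M * ω) / (rPlus a M - rMinus a M))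

/-- The weight of Whiting's integral transformation, in terms of `s = r - r₊`. -/
noncomputable def whitingWeight (a M : ℝ) (ω : ℂ) (m : ℤ) (s : ℝ) : ℂ :=
  (s : ℂ) ^ horizonExponent a M ω m *
    (((s + (rPlus a M - rMinus a M) : ℝ) : ℂ) ^ innerExponent a M ω m *
      Complex.exp (-(Complex.I * ω) * s))

/-- The constant coefficient of the confluent Heun equation satisfied by the radial function
stripped of its exponents. -/
noncomputable def heunConst (a M : ℝ) (ω : ℂ) (m : ℤ) (lam : ℂ) : ℂ :=
  -(2 * Complex.I * M * ω) - Complex.I * ω * (rPlus a M - rMinus a M)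
    + 2 * ω * (a * m - 2 * M * rPlus a M * ω)
    + 4 * M * rPlus a M * ω ^ 2 - lam - a ^ 2 * ω ^ 2

theorem horizonExponent_mul (h : |a| < M) (ω : ℂ) (m : ℤ) :
    horizonExponent a M ω m * (rPlus a M - rMinus a M : ℝ) =
      Complex.I * (a * m - 2 * M * rPlus a M * ω) := by
  obtain ⟨-, -, h2, -, -⟩ := horizon_facts h
  have : ((rPlus a M - rMinus a M : ℝ) : ℂ) ≠ 0 := by exact_mod_cast (by linarith)
  unfold horizonExponent
  rw [← Complex.ofReal_sub, div_mul_cancel₀ _ this]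

theorem horizonExponent_add (h : |a| < M) (ω : ℂ) (m : ℤ) :
    horizonExponent a M ω m + innerExponent a M ω m = -(2 * Complex.I * M * ω) := by
  obtain ⟨-, -, h2, -, -⟩ := horizon_facts h
  have : (rPlus a M - rMinus a M : ℂ) ≠ 0 := by
    exact_mod_cast (by linarith : rPlus a M - rMinus a M ≠ 0)
  unfold horizonExponent innerExponent
  field_simp
  ring

/-- The real part is `-2 M r₋ Im ω / (r₊ - r₋)`. Its sign bounds the factor `(s + d)^η` of the
weight by its value at `s = 0`. -/
theorem re_innerExponent_nonpos (h : |a| < M) {ω : ℂ} (hω : 0 < ω.im) (m : ℤ) :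
    (innerExponent a M ω m).re ≤ 0 := by
  obtain ⟨h1, h0, h2, -, -⟩ := horizon_facts h
  have hM : 0 < M := (abs_nonneg a).trans_lt h
  have e : innerExponent a M ω m = (((rPlus a M - rMinus a M)⁻¹ : ℝ) : ℂ) *
      (Complex.I * (((2 * M * rMinus a M : ℝ) : ℂ) * ω - ((a * m : ℝ) : ℂ))) := by
    unfold innerExponent
    push_cast
    ring
  rw [e, Complex.re_ofReal_mul, Complex.I_mul_re, Complex.sub_im, Complex.ofReal_im,
    Complex.im_ofReal_mul]
  have : 0 < rPlus a M - rMinus a M := by linarith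
  have : 0 ≤ 2 * M * rMinus a M * ω.im := by positivity
  exact mul_nonpos_of_nonneg_of_nonpos (by positivity) (by linarith)

theorem hasDerivAt_whitingWeight (h : |a| < M) (ω : ℂ) (m : ℤ) {s : ℝ} (hs : 0 < s) :
    HasDerivAt (whitingWeight a M ω m) (whitingWeight a M ω m s *
      (horizonExponent a M ω m / s
        + innerExponent a M ω m / (s + (rPlus a M - rMinus a M : ℝ)) - Complex.I * ω)) s := by
  obtain ⟨-, -, h2, -, -⟩ := horizon_facts h
  set d := rPlus a M - rMinus a M with hd
  have hsd : 0 < s + d := by linarith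
  have h3 : HasDerivAt (fun s : ℝ ↦ Complex.exp (-(Complex.I * ω) * s))
      (Complex.exp (-(Complex.I * ω) * s) * (-(Complex.I * ω))) s := by
    simpa using ((hasDerivAt_id s).ofReal_comp.const_mul (-(Complex.I * ω))).cexp
  have h4 := (hasDerivAt_ofReal_cpow_of_pos (innerExponent a M ω m) hsd).comp_add_const s d
  refine ((hasDerivAt_ofReal_cpow_of_pos (horizonExponent a M ω m) hs).mul
    (h4.mul h3)).congr_deriv ?_
  have e1 : (s : ℂ) ≠ 0 := by exact_mod_cast hs.ne'
  have e2 : ((s + d : ℝ) : ℂ) ≠ 0 := by exact_mod_cast hsd.ne'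
  rw [Complex.cpow_sub _ _ e1, Complex.cpow_sub _ _ e2, Complex.cpow_one, Complex.cpow_one]
  unfold whitingWeight
  rw [← hd, ← Complex.ofReal_add]
  simp only [Pi.mul_apply]
  field_simp
  ring

/-- The growth is that of `|e^{-iωs}| = e^{Im ω · s}`; the margin `b - Im ω` absorbs `s^ξ`. -/
theorem isExpBounded_whitingWeight (h : |a| < M) {ω : ℂ} (hω : 0 < ω.im) (m : ℤ) {b : ℝ}
    (hb : ω.im < b) : IsExpBounded b (whitingWeight a M ω m) := by
  obtain ⟨-, -, h2, -, -⟩ := horizon_facts h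
  have hd : 0 < rPlus a M - rMinus a M := by linarith
  have h1 := IsExpBounded.cpow (re_horizonExponent_pos h hω m) (sub_pos.2 hb)
  have h3 := IsExpBounded.cexp (-(Complex.I * ω))
  have h4 : IsExpBounded 0 (fun s : ℝ ↦
      ((s + (rPlus a M - rMinus a M) : ℝ) : ℂ) ^ innerExponent a M ω m) := by
    refine ⟨fun s hs ↦ ?_, (rPlus a M - rMinus a M) ^ (innerExponent a M ω m).re, fun s hs ↦ ?_⟩
    · have hs' : (0 : ℝ) < s := hs
      exact ((hasDerivAt_ofReal_cpow_of_pos _ (by linarith)).comp_add_const s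
        (rPlus a M - rMinus a M)).continuousAt.continuousWithinAt
    · rw [Complex.norm_cpow_eq_rpow_re_of_pos (by linarith), zero_mul, Real.exp_zero, mul_one]
      exact Real.rpow_le_rpow_of_nonpos hd (by linarith) (re_innerExponent_nonpos h hω m)
  have h5 := h1.mul (h4.mul h3)
  refine h5.mono (le_of_eq ?_)
  simp

theorem tendsto_whitingWeight_zero (h : |a| < M) {ω : ℂ} (hω : 0 < ω.im) (m : ℤ) :
    Tendsto (whitingWeight a M ω m) (𝓝[>] 0) (𝓝 0) := by
  obtain ⟨-, -, h2, -, -⟩ := horizon_facts h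
  have h1 := tendsto_ofReal_cpow_zero (re_horizonExponent_pos h hω m)
  have h3 : ContinuousAt (fun s : ℝ ↦
      ((s + (rPlus a M - rMinus a M) : ℝ) : ℂ) ^ innerExponent a M ω m *
        Complex.exp (-(Complex.I * ω) * s)) 0 :=
    ((hasDerivAt_ofReal_cpow_of_pos _ (by linarith)).comp_add_const 0
        (rPlus a M - rMinus a M)).continuousAt.mul (by fun_prop)
  have h4 := h1.mul (h3.tendsto.mono_left (nhdsWithin_le_nhds (s := Ioi 0)))
  rw [zero_mul] at h4
  exact h4

/-- With `P = Δ W' / W` and `N` the numerator, the left side is `N + P² + Δ P'`, that is, `Δ / W`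
times the radial operator applied to `W`. Divisibility by `Δ` holds because `ξ` and `η` are indicial
exponents at the two roots; the factor `e^{-iωs}` cancels the leading growth and leaves a linear
quotient. -/
theorem radialNumerator_eval_add (h : |a| < M) (ω : ℂ) (m : ℤ) (lam s : ℂ) :
    (radialNumerator a M ω m lam).eval s
      + (-(2 * Complex.I * M * ω) * s + Complex.I * (a * m - 2 * M * rPlus a M * ω)
        - Complex.I * ω * (s * (s + (rPlus a M - rMinus a M : ℝ)))) ^ 2
      + s * (s + (rPlus a M - rMinus a M : ℝ)) * (-(2 * Complex.I * M * ω)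
        - Complex.I * ω * (2 * s + (rPlus a M - rMinus a M : ℝ))) =
    s * (s + (rPlus a M - rMinus a M : ℝ)) *
      (-(2 * Complex.I * ω) * s + heunConst a M ω m lam) := by
  obtain ⟨-, -, -, h1, h2⟩ := horizon_facts h
  have h1' : (M : ℂ) = (rPlus a M + rMinus a M) / 2 := by
    rw [← Complex.ofReal_add, h1]; push_cast; ring
  have h2' : (a : ℂ) ^ 2 = rPlus a M * rMinus a M := by
    rw [← Complex.ofReal_mul, h2]; push_cast; ring
  simp only [radialNumerator, heunConst, Polynomial.eval_add, Polynomial.eval_sub,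
    Polynomial.eval_mul, Polynomial.eval_pow, Polynomial.eval_X, Polynomial.eval_C]
  generalize rPlus a M = p at *
  generalize rMinus a M = q at *
  rw [h1']
  push_cast
  linear_combination (-(p + q) * ω * s + (a * m - (p + q) * p * ω) - ω * (s * (s + (p - q)))) ^ 2
    * Complex.I_sq + ω ^ 2 * (2 * (s + p) ^ 2 + a ^ 2 + p * q) * h2'

end Kerr

end Transform

/-! ### The differential equation of the Laplace transform -/

section WhitingEquation

open Topology MeasureTheory ComplexConjugate

namespace Kerr

variable {a M : ℝ} {ω : ℂ} {m : ℤ} {lam : ℂ} {u T : ℝ → ℂ}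

theorem isExpBounded_whitingWeight_mul (h : |a| < M) (hω : 0 < ω.im) (m : ℤ) {k : ℝ → ℂ}
    (hk : ∀ μ > 0, IsExpBounded μ k) {b : ℝ} (hb : ω.im < b) :
    IsExpBounded b (fun s ↦ whitingWeight a M ω m s * k s) := by
  obtain ⟨x, hx, hxb⟩ := exists_between hb
  refine ((isExpBounded_whitingWeight h hω m hx).mul (hk (b - x) (by linarith))).mono ?_
  linarith

/-- Green's identity for Whiting's integral kernel and a solution of the radial equation. -/
theorem IsBoundedRadialSystem.laplace_identity (hu : IsBoundedRadialSystem a M ω m lam u T)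
    (h : |a| < M) (hω : 0 < ω.im) {z : ℂ} (hz : ω.im < z.re) :
    (-(z * ((rPlus a M - rMinus a M : ℝ) + 2 * (Complex.I * (a * m - 2 * M * rPlus a M * ω))))
        + heunConst a M ω m lam) * laplace (fun s ↦ whitingWeight a M ω m s * u s) z
      + ((rPlus a M - rMinus a M : ℝ) * z ^ 2 - z * (2 - 4 * Complex.I * M * ω
          - 2 * Complex.I * ω * (rPlus a M - rMinus a M : ℝ)) - 2 * Complex.I * ω)
        * laplace (fun s ↦ s * (whitingWeight a M ω m s * u s)) z
      + (z ^ 2 + 2 * Complex.I * ω * z)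
        * laplace (fun s ↦ s * (s * (whitingWeight a M ω m s * u s))) z = 0 := by
  obtain ⟨-, -, h2, -, -⟩ := horizon_facts h
  have hxd := horizonExponent_mul h ω m
  have hxa := horizonExponent_add h ω m
  have hnum := fun s : ℂ ↦ radialNumerator_eval_add h ω m lam s
  have hW' := fun (s : ℝ) (hs : 0 < s) ↦ hasDerivAt_whitingWeight h ω m hs
  have hu1 := hu.hasDerivAt_fst
  have hu2 := hu.hasDerivAt_snd
  set d : ℝ := rPlus a M - rMinus a M with hd
  have hd0 : 0 < d := by linarith
  set W := whitingWeight a M ω m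
  set ξ := horizonExponent a M ω m
  set η := innerExponent a M ω m
  set X : ℂ := Complex.I * (a * m - 2 * M * rPlus a M * ω)
  set β := heunConst a M ω m lam
  set q₀ : ℂ := -(z * (d + 2 * X)) + β
  set q₁ : ℂ := d * z ^ 2 - z * (2 - 4 * Complex.I * M * ω - 2 * Complex.I * ω * d)
    - 2 * Complex.I * ω
  set q₂ : ℂ := z ^ 2 + 2 * Complex.I * ω * z
  -- `p` is `Δ` times the logarithmic derivative of the kernel `K = e^{-zs} W`. Hence `B` below is
  -- the Wronskian `K Δ u' - u Δ K'`, and `B'` is `-u` times the radial operator applied to `K`.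
  set p : Polynomial ℂ := -(Polynomial.C (2 * Complex.I * M * ω) * Polynomial.X) + Polynomial.C X
    - Polynomial.C (Complex.I * ω + z) * (Polynomial.X * (Polynomial.X + Polynomial.C (d : ℂ))) with hp
  have hpe : ∀ s : ℂ, p.eval s = -(2 * Complex.I * M * ω) * s + X
      - (Complex.I * ω + z) * (s * (s + d)) := by
    intro s
    simp [hp]
  have hpd : ∀ s : ℂ, p.derivative.eval s = -(2 * Complex.I * M * ω)
      - (Complex.I * ω + z) * (2 * s + d) := by
    intro s
    simp [hp, -mul_eq_mul_left_iff]
    ring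
  have huμ : ∀ μ > 0, IsExpBounded μ u := fun μ hμ ↦ hu.bounded.mono hμ.le
  set k : ℝ → ℂ := fun s ↦ T s + -1 * (p.eval (s : ℂ) * u s)
  have hkμ : ∀ μ > 0, IsExpBounded μ k := fun μ hμ ↦
    (hu.flux_bounded μ hμ).add ((hu.bounded.polynomial_mul hμ p).const_mul (-1))
  obtain ⟨b, hb, hbz⟩ := exists_between hz
  obtain ⟨b', hb', hbb'⟩ := exists_between hb
  have hWk := isExpBounded_whitingWeight_mul h hω m hkμ hb
  have hh₀ : IsExpBounded b' (fun s ↦ W s * u s) := isExpBounded_whitingWeight_mul h hω m huμ hb'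
  obtain ⟨b₁, hb₁, hb₁b⟩ := exists_between hbb'
  have hh₁ := hh₀.id_mul hb₁
  have hh₂ := hh₁.id_mul hb₁b
  set B : ℝ → ℂ := fun s ↦ Complex.exp (-z * s) * (W s * k s) with hB
  have hderiv : ∀ s ∈ Ioi (0 : ℝ), HasDerivAt B
      (-(q₀ * (Complex.exp (-z * s) * (W s * u s)) + q₁ * (Complex.exp (-z * s) * (s * (W s * u s)))
        + q₂ * (Complex.exp (-z * s) * (s * (s * (W s * u s)))))) s := by
    intro s hs
    have hs0 : (0 : ℝ) < s := hs
    have e1 : (s : ℂ) ≠ 0 := by exact_mod_cast hs0.ne'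
    have e2 : (s + d : ℂ) ≠ 0 := by exact_mod_cast (by positivity : s + d ≠ 0)
    have hexp : HasDerivAt (fun s : ℝ ↦ Complex.exp (-z * s)) (Complex.exp (-z * s) * (-z)) s := by
      simpa using ((hasDerivAt_id s).ofReal_comp.const_mul (-z)).cexp
    have hpder : HasDerivAt (fun s : ℝ ↦ p.eval (s : ℂ)) (p.derivative.eval (s : ℂ)) s :=
      (p.hasDerivAt (s : ℂ)).comp_ofReal
    have hWs : HasDerivAt W (W s * ((p.eval (s : ℂ) + z * (s * (s + d))) / (s * (s + d)))) s := by
      refine (hW' s hs0).congr_deriv ?_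
      congr 1
      rw [hpe, ← hxa, ← hxd]
      field_simp
      ring
    have hks := (hu2 s hs0).add ((hpder.mul (hu1 s hs0)).const_mul (-1))
    refine (hexp.mul (hWs.mul hks)).congr_deriv ?_
    -- `p + z Δ` is `Δ W' / W`, so this is the cancellation identity for `W` solved for the
    -- numerator; it removes every denominator from `B'`.
    have hn : (radialNumerator a M ω m lam).eval (s : ℂ) = s * (s + d) *
        (-(2 * Complex.I * ω) * s + β) - (p.eval (s : ℂ) + z * (s * (s + d))) ^ 2
        - s * (s + d) * (p.derivative.eval (s : ℂ) + z * (2 * s + d)) := by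
      rw [hpe, hpd]
      linear_combination hnum (s : ℂ)
    rw [hn]
    simp only [Pi.mul_apply, Pi.add_apply]
    rw [hpd, hpe]
    field_simp
    ring
  have hint : IntegrableOn (fun s : ℝ ↦ -(q₀ * (Complex.exp (-z * s) * (W s * u s))
      + q₁ * (Complex.exp (-z * s) * (s * (W s * u s)))
      + q₂ * (Complex.exp (-z * s) * (s * (s * (W s * u s)))))) (Ioi 0) :=
    ((((hh₀.integrableOn (by linarith)).const_mul q₀).add
      ((hh₁.integrableOn (by linarith)).const_mul q₁)).add
      ((hh₂.integrableOn hbz).const_mul q₂)).neg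
  -- The value at `s = 0` is the convention `0 ^ ξ = 0` for `ξ ≠ 0`; it agrees with the limit
  -- because `Re ξ > 0`.
  have hB0 : B 0 = 0 := by
    have : ξ ≠ 0 := by
      intro h0
      have := re_horizonExponent_pos h hω m
      simp [ξ, h0] at this
    have hW0 : W 0 = 0 := by
      change ((0 : ℝ) : ℂ) ^ ξ * _ = 0
      rw [Complex.ofReal_zero, Complex.zero_cpow this, zero_mul]
    simp only [hB, hW0, zero_mul, mul_zero]
  have hcont : ContinuousWithinAt B (Ici 0) 0 := by
    rw [← continuousWithinAt_Ioi_iff_Ici, ContinuousWithinAt, hB0]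
    have h1 := ((IsExpBounded.cexp (-z)).mul (hkμ 1 one_pos)).tendsto_zero_mul
      (tendsto_whitingWeight_zero h hω m)
    refine h1.congr fun s ↦ ?_
    simp only [hB]
    ring
  have hlim : Tendsto B atTop (𝓝 0) := by
    have h1 : IsExpBounded ((-z).re + b) B := (IsExpBounded.cexp (-z)).mul hWk
    exact h1.tendsto_atTop (by rw [Complex.neg_re]; linarith)
  have key := integral_Ioi_of_hasDerivAt_of_tendsto hcont hderiv hint hlim
  rw [hB0, sub_zero, integral_neg, neg_eq_zero, integral_add, integral_add, integral_const_mul,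
    integral_const_mul, integral_const_mul] at key
  · exact key
  · exact (hh₀.integrableOn (by linarith)).const_mul q₀
  · exact (hh₁.integrableOn (by linarith)).const_mul q₁
  · exact ((hh₀.integrableOn (by linarith)).const_mul q₀).add
      ((hh₁.integrableOn (by linarith)).const_mul q₁)
  · exact (hh₂.integrableOn hbz).const_mul q₂

end Kerr

end WhitingEquation

/-! ### The transformed equation and the vanishing of modes -/

section ModeStability

open Topology ComplexConjugate

namespace Kerr

variable {a M : ℝ} {ω : ℂ} {m : ℤ} {lam : ℂ} {u T : ℝ → ℂ}

/-- The potential of the transformed radial equation, in terms of `y = x - r₊`. -/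
noncomputable def whitingPotential (a M : ℝ) (ω : ℂ) (m : ℤ) (lam : ℂ) (y : ℝ) : ℂ :=
  ((y + (rPlus a M - rMinus a M)) * (y - 2 * M) ^ 2 / y
      + 8 * M * rPlus a M * (1 + y / (rPlus a M - rMinus a M)) - a ^ 2 : ℝ) * ω ^ 2
    - (a * m * (4 * (y / (rPlus a M - rMinus a M)) + 2) : ℝ) * ω - lam

/-- The `ω²` coefficient is positive since `a² = r₊ r₋ ≤ 2 M r₊`, and after multiplication by `ω̄`
it contributes a positive multiple of `Im ω`. The term linear in `ω` becomes real, and `-Im (ω̄ λ) ≥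
0`. -/
theorem im_conj_mul_whitingPotential_pos (h : |a| < M) (hω : 0 < ω.im)
    (hlam : (conj ω * lam).im ≤ 0) {y : ℝ} (hy : 0 < y) :
    0 < (conj ω * whitingPotential a M ω m lam y).im := by
  obtain ⟨h1, h0, h2, h3, h4⟩ := horizon_facts h
  have hM : 0 < M := (abs_nonneg a).trans_lt h
  unfold whitingPotential
  set A : ℝ := (y + (rPlus a M - rMinus a M)) * (y - 2 * M) ^ 2 / y
      + 8 * M * rPlus a M * (1 + y / (rPlus a M - rMinus a M)) - a ^ 2 with hA
  set B : ℝ := a * m * (4 * (y / (rPlus a M - rMinus a M)) + 2)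
  have hd : 0 < rPlus a M - rMinus a M := by linarith
  have hApos : 0 < A := by
    have e1 : 0 ≤ (y + (rPlus a M - rMinus a M)) * (y - 2 * M) ^ 2 / y := by positivity
    have e2 : 0 ≤ 8 * M * rPlus a M * (y / (rPlus a M - rMinus a M)) := by positivity
    have e3 : a ^ 2 ≤ 2 * M * rPlus a M := by
      rw [← h4, ← h3]
      nlinarith
    have e4 : 0 < M * rPlus a M := by positivity
    rw [hA, mul_add]
    linarith
  have e : conj ω * ((A : ℂ) * ω ^ 2 - (B : ℂ) * ω - lam) =
      ((A * Complex.normSq ω : ℝ) : ℂ) * ω - ((B * Complex.normSq ω : ℝ) : ℂ) - conj ω * lam := by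
    push_cast
    rw [Complex.normSq_eq_conj_mul_self]
    ring
  rw [e, Complex.sub_im, Complex.sub_im, Complex.im_ofReal_mul, Complex.ofReal_im]
  have hne : ω ≠ 0 := by rintro rfl; simp at hω
  have : 0 < A * Complex.normSq ω * ω.im :=
    mul_pos (mul_pos hApos (Complex.normSq_pos.2 hne)) hω
  linarith

/-- The prefactor of Whiting's integral transformation. -/
noncomputable def whitingFactor (M : ℝ) (ω : ℂ) (y : ℝ) : ℂ :=
  (y : ℂ) ^ (-(2 * Complex.I * M * ω)) * Complex.exp (Complex.I * ω * y)

theorem hasDerivAt_whitingFactor (M : ℝ) (ω : ℂ) {y : ℝ} (hy : 0 < y) :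
    HasDerivAt (whitingFactor M ω)
      (whitingFactor M ω y * (-(2 * Complex.I * M * ω) / y + Complex.I * ω)) y := by
  have h3 : HasDerivAt (fun s : ℝ ↦ Complex.exp (Complex.I * ω * s))
      (Complex.exp (Complex.I * ω * y) * (Complex.I * ω)) y := by
    simpa using ((hasDerivAt_id y).ofReal_comp.const_mul (Complex.I * ω)).cexp
  refine ((hasDerivAt_ofReal_cpow_of_pos _ hy).mul h3).congr_deriv ?_
  have e1 : (y : ℂ) ≠ 0 := by exact_mod_cast hy.ne'
  rw [Complex.cpow_sub _ _ e1, Complex.cpow_one]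
  unfold whitingFactor
  field_simp

theorem re_whitingFactor_exponent (M : ℝ) (ω : ℂ) :
    (-(2 * Complex.I * M * ω)).re = 2 * M * ω.im := by
  simp [mul_assoc]

theorem IsBoundedRadialSystem.eq_zero (hu : IsBoundedRadialSystem a M ω m lam u T)
    (h : |a| < M) (hω : 0 < ω.im) (hlam : (conj ω * lam).im ≤ 0) : ∀ s > 0, u s = 0 := by
  have hM : 0 < M := (abs_nonneg a).trans_lt h
  obtain ⟨hp, -, h2, -, -⟩ := horizon_facts h
  set d : ℝ := rPlus a M - rMinus a M with hd
  have hd0 : 0 < d := by linarith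
  have hdc : (d : ℂ) ≠ 0 := by exact_mod_cast hd0.ne'
  -- The coefficient `z (z + 2iω)` of the second derivative vanishes at `z = 0` and `z = -2iω`. The
  -- substitution `z = -σ (y + d)` moves these points to `y = -d` and `y = 0` and turns the
  -- coefficient into `σ² y (y + d)`.
  set σ : ℂ := 2 * Complex.I * ω / d with hσ
  have hσd : σ * d = 2 * Complex.I * ω := div_mul_cancel₀ _ hdc
  have hz₀ : (-(2 * Complex.I * ω)).re = 2 * ω.im := by simp [mul_assoc]
  have hz₁ : 0 < (-σ).re := by
    have : -σ = ((d⁻¹ : ℝ) : ℂ) * (-(2 * Complex.I * ω)) := by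
      rw [hσ]; push_cast; ring
    rw [this, Complex.re_ofReal_mul, hz₀]
    positivity
  set hh : ℝ → ℂ := fun s ↦ whitingWeight a M ω m s * u s
  -- The rates `3/2` and `7/4` only need to increase strictly between `Im ω`, the growth of the
  -- weight, and `2 Im ω = Re (-2iω)`, where the ray starts.
  have hh₀ : IsExpBounded (3 / 2 * ω.im) hh := isExpBounded_whitingWeight_mul h hω m
    (fun μ hμ ↦ hu.bounded.mono hμ.le) (by linarith)
  have hh₁ : IsExpBounded (7 / 4 * ω.im) (fun s ↦ s * hh s) := hh₀.id_mul (by linarith)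
  have hb₀ : 3 / 2 * ω.im < (-(2 * Complex.I * ω)).re := by rw [hz₀]; linarith
  have hb₁ : 7 / 4 * ω.im < (-(2 * Complex.I * ω)).re := by rw [hz₀]; linarith
  set z : ℝ → ℂ := fun y ↦ -(2 * Complex.I * ω) + y * (-σ)
  have hzσ : ∀ y : ℝ, z y = -(σ * (y + d)) := by
    intro y
    linear_combination hσd
  set L₀ : ℝ → ℂ := fun y ↦ laplace hh (z y)
  set L₁ : ℝ → ℂ := fun y ↦ laplace (fun s ↦ s * hh s) (z y)
  set L₂ : ℝ → ℂ := fun y ↦ laplace (fun s ↦ s * (s * hh s)) (z y)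
  have bL₀ : IsExpBounded 0 L₀ := hh₀.laplace_comp hb₀ hz₁
  have bL₁ : IsExpBounded 0 L₁ := hh₁.laplace_comp hb₁ hz₁
  have dL₀ : ∀ y > 0, HasDerivAt L₀ (σ * L₁ y) y := fun y hy ↦
    (hh₀.hasDerivAt_laplace_comp hb₀ hz₁ hy).congr_deriv (by rw [neg_neg])
  have dL₁ : ∀ y > 0, HasDerivAt L₁ (σ * L₂ y) y := fun y hy ↦
    (hh₁.hasDerivAt_laplace_comp hb₁ hz₁ hy).congr_deriv (by rw [neg_neg])
  have dE := fun (y : ℝ) (hy : y > 0) ↦ hasDerivAt_whitingFactor M ω hy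
  set E := whitingFactor M ω
  have hEre : 0 < (-(2 * Complex.I * M * ω)).re := by
    rw [re_whitingFactor_exponent]
    positivity
  -- Half of the decay `e^{-Im ω · y}` is spent on the power of `y`. The polynomials in `F` cost a
  -- further quarter, so `E F` still decays.
  have bE : IsExpBounded (-(1 / 2 * ω.im)) E := by
    have h1 := (IsExpBounded.cpow hEre (by linarith : 0 < 1 / 2 * ω.im)).mul
      (IsExpBounded.cexp (Complex.I * ω))
    refine h1.mono (le_of_eq ?_)
    simp
    ring
  have hE0 : Tendsto E (𝓝[>] 0) (𝓝 0) := by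
    have h1 := (IsExpBounded.cexp (Complex.I * ω)).tendsto_zero_mul
      (tendsto_ofReal_cpow_zero hEre)
    exact h1
  -- `p₀` and `p₁` are the coefficients of `L₀` and `L₁` in `y (y + d) v' / E` for `v = E L₀`; the
  -- pole of `E' / E` at `y = 0` has cancelled.
  set p₀ : Polynomial ℂ := Polynomial.C (Complex.I * ω) *
    ((Polynomial.X + Polynomial.C (d : ℂ)) * (Polynomial.X - Polynomial.C (2 * M : ℂ))) with hp₀
  set p₁ : Polynomial ℂ := Polynomial.C σ * (Polynomial.X * (Polynomial.X + Polynomial.C (d : ℂ)))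
    with hp₁
  have ep₀ : ∀ y : ℂ, p₀.eval y = Complex.I * ω * ((y + d) * (y - 2 * M)) := by
    intro y; simp [hp₀]
  have ep₁ : ∀ y : ℂ, p₁.eval y = σ * (y * (y + d)) := by
    intro y; simp [hp₁]
  have edp₀ : ∀ y : ℂ, p₀.derivative.eval y = Complex.I * ω * (2 * y + d - 2 * M) := by
    intro y
    simp [hp₀, -mul_eq_mul_left_iff]
    ring
  have edp₁ : ∀ y : ℂ, p₁.derivative.eval y = σ * (2 * y + d) := by
    intro y
    simp [hp₁, -mul_eq_mul_left_iff]
    ring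
  set F : ℝ → ℂ := fun y ↦ p₀.eval (y : ℂ) * L₀ y + p₁.eval (y : ℂ) * L₁ y
  have bF : IsExpBounded (1 / 4 * ω.im) F :=
    (bL₀.polynomial_mul (by linarith) p₀).add (bL₁.polynomial_mul (by linarith) p₁)
  have bv : IsExpBounded (-(1 / 2 * ω.im) + 0) (fun y ↦ E y * L₀ y) := bE.mul bL₀
  have bT : IsExpBounded (-(1 / 2 * ω.im) + 1 / 4 * ω.im) (fun y ↦ E y * F y) := bE.mul bF
  have key := sturmLiouville_energy (convex_Ioi (0 : ℝ)) isOpen_Ioi (l₁ := 𝓝[>] 0) (l₂ := atTop)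
    (fun x hx ↦ ?_) (fun x hx ↦ ?_) hω (p := fun y ↦ y * (y + d)) (v := fun y ↦ E y * L₀ y)
    (v' := fun y ↦ E y * (-(2 * Complex.I * M * ω) / y + Complex.I * ω) * L₀ y + E y * (σ * L₁ y))
    (T := fun y ↦ E y * F y) (q := whitingPotential a M ω m lam)
    (fun y hy ↦ (dE y hy).mul (dL₀ y hy)) (fun y hy ↦ ?_) (fun y hy ↦ ?_) (fun y hy ↦ ?_)
    (fun y hy ↦ (im_conj_mul_whitingPotential_pos h hω hlam hy).le) ?_ ?_
  · have hL₀ : ∀ y : ℝ, 0 < y → L₀ y = 0 := by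
      intro y hy
      have h1 := key y hy
      have h3 : E y ≠ 0 := by
        have : (y : ℂ) ≠ 0 := by exact_mod_cast hy.ne'
        exact mul_ne_zero (by simp [Complex.cpow_eq_zero_iff, this]) (Complex.exp_ne_zero _)
      have h4 := (mul_eq_zero.1 h1).resolve_left (im_conj_mul_whitingPotential_pos h hω hlam hy).ne'
      exact (mul_eq_zero.1 (norm_eq_zero.1 (pow_eq_zero_iff two_ne_zero |>.1 h4))).resolve_left h3
    intro s hs
    have h1 := hh₀.eq_zero_of_laplace_eq_zero hb₀ hz₁ hL₀ s hs
    have hW : whitingWeight a M ω m s ≠ 0 := by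
      have e1 : (s : ℂ) ≠ 0 := by exact_mod_cast hs.ne'
      have e2 : ((s + d : ℝ) : ℂ) ≠ 0 := by exact_mod_cast (by positivity : s + d ≠ 0)
      exact mul_ne_zero (by simp [Complex.cpow_eq_zero_iff, e1])
        (mul_ne_zero (fun h0 ↦ e2 ((Complex.cpow_eq_zero_iff _ _).1 h0).1) (Complex.exp_ne_zero _))
    exact (mul_eq_zero.1 h1).resolve_left hW
  · filter_upwards [self_mem_nhdsWithin, nhdsWithin_le_nhds (Iic_mem_nhds hx)] with y h1 h2
    exact ⟨h1, h2⟩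
  · filter_upwards [eventually_gt_atTop 0, eventually_ge_atTop x] with y h1 h2
    exact ⟨h1, h2⟩
  · have hy0 : 0 < y := hy
    have ey : (y : ℂ) ≠ 0 := by exact_mod_cast hy0.ne'
    have dp : ∀ p : Polynomial ℂ,
        HasDerivAt (fun s : ℝ ↦ p.eval (s : ℂ)) (p.derivative.eval (y : ℂ)) y :=
      fun p ↦ (p.hasDerivAt (y : ℂ)).comp_ofReal
    refine ((dE y hy).mul (((dp p₀).mul (dL₀ y hy)).add ((dp p₁).mul (dL₁ y hy)))).congr_deriv ?_
    have hre : ω.im < (z y).re := by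
      have : 0 < y * (-σ).re := mul_pos hy0 hz₁
      have e : (z y).re = 2 * ω.im + y * (-σ).re := by
        rw [← hz₀, ← Complex.re_ofReal_mul, ← Complex.add_re]
      rw [e]
      linarith
    have hid := hu.laplace_identity h hω hre
    change _ * L₀ y + _ * L₁ y + _ * L₂ y = 0 at hid
    simp only [Pi.add_apply, Pi.mul_apply]
    rw [edp₀, edp₁, ep₀, ep₁]
    rw [hzσ, ← hd] at hid
    unfold heunConst at hid
    unfold whitingPotential
    rw [← hd]
    push_cast
    have he : (y / d : ℂ) * d = y := div_mul_cancel₀ _ hdc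
    have hyy : (y : ℂ) * (y : ℂ)⁻¹ = 1 := mul_inv_cancel₀ ey
    -- The equation for `v` follows from the Laplace identity by comparing the coefficients of `L₀`,
    -- `L₁` and `L₂` separately.
    have c₀ : (-(2 * Complex.I * M * ω) / y + Complex.I * ω) *
        (Complex.I * ω * ((y + d) * (y - 2 * M))) + Complex.I * ω * (2 * y + d - 2 * M) +
        (((y + d) * (y - 2 * M) ^ 2 / y + 8 * M * rPlus a M * (1 + y / d) - (a : ℂ) ^ 2) * ω ^ 2 -
          a * m * (4 * (y / d) + 2) * ω - lam) =
        -(-(σ * (y + d)) * (d + 2 * (Complex.I * (a * m - 2 * M * rPlus a M * ω)))) +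
        (-(2 * Complex.I * M * ω) - Complex.I * ω * (rPlus a M - rMinus a M)
          + 2 * ω * (a * m - 2 * M * rPlus a M * ω)
          + 4 * M * rPlus a M * ω ^ 2 - lam - a ^ 2 * ω ^ 2) := by
      have hdd : (rPlus a M - rMinus a M : ℂ) = d := by rw [hd]; push_cast; ring
      rw [hdd]
      generalize (y / d : ℂ) = e at he ⊢
      linear_combination
        (ω ^ 2 * (y + d) * (y - 2 * M) ^ 2 * (y : ℂ)⁻¹
          - 4 * ω * (1 + e) * (a * m - 2 * M * rPlus a M * ω)) * Complex.I_sq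
        - (1 + e) * (d + 2 * (Complex.I * (a * m - 2 * M * rPlus a M * ω))) * hσd
        + (σ * (d + 2 * (Complex.I * (a * m - 2 * M * rPlus a M * ω))) - 2 * Complex.I * ω) * he
        - Complex.I ^ 2 * ω ^ 2 * (y + d) * (y - 2 * M) * hyy
    have c₁ : (-(2 * Complex.I * M * ω) / y + Complex.I * ω) * (σ * (y * (y + d))) +
        Complex.I * ω * ((y + d) * (y - 2 * M)) * σ + σ * (2 * y + d) =
        d * (-(σ * (y + d))) ^ 2 - -(σ * (y + d)) * (2 - 4 * Complex.I * M * ω -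
          2 * Complex.I * ω * d) - 2 * Complex.I * ω := by
      linear_combination (-(σ * (y + d) ^ 2 + 1)) * hσd
        - 2 * Complex.I * M * ω * σ * (y + d) * hyy
    have c₂ : σ * (y * (y + d)) * σ =
        (-(σ * (y + d))) ^ 2 + 2 * Complex.I * ω * -(σ * (y + d)) := by
      linear_combination (-(σ * (y + d))) * hσd
    linear_combination E y * hid + E y * L₀ y * c₀ + E y * L₁ y * c₁ + E y * L₂ y * c₂
  · have hy0 : 0 < y := hy
    have ey : (y : ℂ) ≠ 0 := by exact_mod_cast hy0.ne'
    simp only [F]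
    rw [ep₀, ep₁]
    push_cast
    field_simp
    ring
  · have hy0 : 0 < y := hy
    positivity
  · refine (bT.mul bL₀.star_comp).tendsto_zero_mul
      (((Complex.continuous_conj.tendsto 0).comp hE0).trans (by simp)) |>.congr fun y ↦ ?_
    simp only [Function.comp_apply, map_mul]
    ring
  · refine (bT.mul bv.star_comp).tendsto_atTop ?_
    linarith

theorem continuous_spherePoint (φ : ℝ) : Continuous fun θ ↦ spherePoint θ φ :=
  (contMDiff_spherePoint φ).continuous

theorem exists_spherePoint_eq (x : S2) :
    ∃ θ ∈ Icc 0 Real.pi, ∃ φ, spherePoint θ φ = x := by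
  obtain ⟨x, hx⟩ := x
  rw [mem_sphere_zero_iff_norm, EuclideanSpace.norm_eq, Real.sqrt_eq_one, Fin.sum_univ_three] at hx
  simp only [Real.norm_eq_abs, sq_abs] at hx
  refine ⟨Real.arccos (x 2), ⟨Real.arccos_nonneg _, Real.arccos_le_pi _⟩,
    Complex.arg ⟨x 0, x 1⟩, ?_⟩
  have hsin : Real.sin (Real.arccos (x 2)) = ‖(⟨x 0, x 1⟩ : ℂ)‖ := by
    rw [Real.sin_arccos, Complex.norm_eq_sqrt_sq_add_sq]
    congr 1
    linarith
  have hcos : Real.cos (Real.arccos (x 2)) = x 2 := by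
    apply Real.cos_arccos <;> nlinarith [sq_nonneg (x 0), sq_nonneg (x 1)]
  refine Subtype.ext (PiLp.ext fun i ↦ ?_)
  fin_cases i
  · simp [spherePoint, hsin, Complex.norm_mul_cos_arg]
  · simp [spherePoint, hsin, Complex.norm_mul_sin_arg]
  · simp [spherePoint, hcos]

end Kerr

end ModeStability

theorem theorem1p2 (a M : ℝ) (haM : |a| < M) (ω : ℂ) (hω : 0 < ω.im) (m : ℤ)
    (ψ : ℝ × ℝ × Kerr.S2 → ℂ) (hψ : Kerr.IsModeSolution a M ω m ψ) :
    ∀ p ∈ Kerr.exterior a M, ψ p = 0 := by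
  obtain ⟨lam, S, R, hS, hR, hhor, hinf, hsep⟩ := hψ.separated
  have hRzero : ∀ r ∈ Ioi (Kerr.rPlus a M), R r = 0 := by
    intro r hr
    simpa using (hR.isBoundedRadialSystem haM hω hhor hinf).eq_zero haM hω
      (hS.im_conj_mul_eigenvalue_nonpos hω) (r - Kerr.rPlus a M) (sub_pos.2 hr)
  rintro ⟨t, r, x⟩ hp
  obtain ⟨θ, hθ, φ, rfl⟩ := Kerr.exists_spherePoint_eq x
  have hr : r ∈ Ioi (Kerr.rPlus a M) := hp
  have hopen : IsOpen (Kerr.exterior a M) :=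
    isOpen_lt continuous_const (continuous_fst.comp continuous_snd)
  have hcont : Continuous fun θ ↦ ψ (t, r, Kerr.spherePoint θ φ) := by
    refine continuous_iff_continuousAt.2 fun θ ↦ ?_
    have h1 : ContinuousAt ψ (t, r, Kerr.spherePoint θ φ) :=
      (hψ.wave.smooth.continuousOn _ hr).continuousAt (hopen.mem_nhds hr)
    have h2 : Continuous fun θ ↦ (t, r, Kerr.spherePoint θ φ) :=
      continuous_const.prodMk (continuous_const.prodMk (Kerr.continuous_spherePoint φ))
    exact h1.comp (f := fun θ ↦ (t, r, Kerr.spherePoint θ φ)) h2.continuousAt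
  -- The separated form is available only off the axis; the poles `θ = 0, π` are reached by
  -- continuity along a meridian.
  have hclosed : IsClosed {θ | ψ (t, r, Kerr.spherePoint θ φ) = 0} :=
    isClosed_eq hcont continuous_const
  have hsub : closure (Ioo 0 Real.pi) ⊆ {θ | ψ (t, r, Kerr.spherePoint θ φ) = 0} :=
    hclosed.closure_subset_iff.2 fun θ hθ ↦ by
      simp only [mem_ofPred_eq, hsep t r hr θ hθ φ, hRzero r hr, mul_zero]
  rw [closure_Ioo Real.pi_pos.ne] at hsub
  exact hsub hθ
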